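/- Let $F$ be a totally real number field of degree $d>1$ with ring of integers $\mathcal O$, different $\mathfrak d$ and real embeddings $\sigma_1,\dots,\sigma_d$; write $a_i=\sigma_i(a)$, and let $S^+$ denote the set of totally positive elements of a set $S\subset F$. Let $\mathfrak c$ be a nonzero fractional ideal, $\mathfrak n$ a nonzero integral ideal, and $$\Gamma=\Gamma_0(\mathfrak c,\mathfrak n)=\left\{\begin{pmatrix}a&b\\c&d\end{pmatrix}: a,d\in\mathcal O,\ b\in(\mathfrak{cd})^{-1},\ c\in\mathfrak{cnd},\ ad-bc\in\mathcal O^{\times+}\right\}.$$ Let $\Gamma_\infty\subset\Gamma$ be the subgroup of all products $\begin{pmatrix}\varepsilon&0\\0&1\end{pmatrix}\begin{pmatrix}\eta&0\\0&\eta\end{pmatrix}\begin{pmatrix}1&b\\0&1\end{pmatrix}$ with $\varepsilon\in\mathcal O^{\times+}$, $\eta\in\mathcal O^\times$, $b\in(\mathfrak{cd})^{-1}$. For $\mathbf k\in\mathbb Z_{\ge0}^d$ and $\gamma=\begin{pmatrix}a&b\\c&d\end{pmatrix}\in \mathrm{GL}_2(F)$ with totally positive determinant put $$(g|_{\mathbf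 k}\gamma)(z)=\prod_{i=1}^d\det(\gamma)_i^{k_i/2}(c_iz_i+d_i)^{-k_i}\; g(\gamma z),\qquad z\in\mathbb H^d ,$$ where $\gamma z$ is the componentwise Möbius action. A Hilbert modular form of weight $\mathbf k$ (and level $\Gamma$) is a holomorphic $f:\mathbb H^d\to\mathbb C$ with $f|_{\mathbf k}\gamma=f$ for all $\gamma\in\Gamma$; it is a cusp form if for every $g\in\mathrm{GL}_2(F)$ with totally positive determinant the Fourier expansion of $f|_{\mathbf k}g$ has constant term $0$. For $\mathbf k,\mathfrak l,\mathbf n\in\mathbb Z_{\ge0}^d$, the $\mathbf n$-th Rankin–Cohen bracket of functions $g,h$, treated as having weights $\mathbf k$ and $\mathfrak l$, is $$[g,h]_{\mathbf n}=\sum_{0\le m_j\le n_j}(-1)^{|\mathbf m|}\binom{\mathbf k+\mathbf n-\mathbf 1}{\mathbf n-\mathbf m}\binom{\mathfrak l+\mathbf n-\mathbf 1}{\mathbf m}\,g^{(\mathbf m)}h^{(\mathbf n-\mathbf m)},$$ with multi-index binomial coefficients and partial derivatives. For a function $\psi$ on $\mathbb H^d$ with $\psi|_{\mathbf k}\gamma=\psi$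 for all $\gamma\in\Gamma_\infty$, put $\mathbb P_{\mathbf k}(\psi;z)=\sum_{M\in\Gamma_\infty\backslash\Gamma}(\psi|_{\mathbf k}M)(z)$. Let $f$ be a Hilbert modular form of weight $\mathbf k\in\mathbb Z_{\ge0}^d$ and level $\Gamma$, let $\mathfrak l\in\mathbb Z_{>2}^d$ and $\mathbf n\in\mathbb Z_{\ge 0}^d$, and let $\phi(z)=\sum_{\nu\in\mathfrak c^+\cup\{0\}}a_\nu\, e^{2\pi i\sum_j\nu_jz_j}$ be a $q$-series with $\phi|_{\mathfrak l}\gamma=\phi$ for all $\gamma\in\Gamma_\infty$ and, for some $\varepsilon>0$, $$a_\nu=O\Big(\prod_{i=1}^d\nu_i^{\,l_i/2-2-\varepsilon}\Big)\qquad(\nu\in\mathfrak c^+).$$ If $f$ is not a cusp form, assume further that $l_i\ge k_i+2$ for all $i$. Then the series defining $\mathbb P_{\mathfrak l}(\phi)$ and $\mathbb P_{\mathbf k+\mathfrak l+2\mathbf n}([f,\phi]_{\mathbf n})$ converge absolutely at every point of $\mathbb H^d$, the function $\mathbb P_{\mathfrak l}(\phi)$ is holomorphic on $\mathbb H^d$,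 and $$[f,\mathbb P_{\mathfrak l}(\phi)]_{\mathbf n}=\mathbb P_{\mathbf k+\mathfrak l+2\mathbf n}\big([f,\phi]_{\mathbf n}\big)\quad\text{on }\mathbb H^d,$$ where both brackets are formed with weights $\mathbf k$ and $\mathfrak l$. -/

import Mathlib

open scoped nonZeroDivisors NumberField MatrixGroups
open NumberField

namespace HilbertPoincare

noncomputable section

/-! ### Functions of several complex variables -/

/-- The product `ℍ^ι` of upper half planes, as an open subset of `ℂ^ι`. -/
def upperHalfSpace (ι : Type*) : Set (ι → ℂ) := {z | ∀ i, 0 < (z i).im}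

open scoped Classical in
/-- The complex partial derivative `∂f/∂z_i`. -/
def partialDeriv {ι : Type*} (i : ι) (f : (ι → ℂ) → ℂ) (z : ι → ℂ) : ℂ :=
  deriv (fun t => f (Function.update z i t)) (z i)

/-- The mixed derivative `f^(m) = (∏ i, (∂/∂z_i)^(m i)) f` for a multi-index `m`
(on holomorphic functions the partial derivatives commute, so their order is immaterial). -/
def multiDeriv {ι : Type*} [Fintype ι] (m : ι → ℕ) (f : (ι → ℂ) → ℂ) : (ι → ℂ) → ℂ :=
  (Finset.univ : Finset ι).toList.foldr (fun i g => (partialDeriv i)^[m i] g) f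

/-- The multi-index binomial coefficient `∏ i, (a i).choose (b i)`. -/
def multiChoose {ι : Type*} [Fintype ι] (a b : ι → ℕ) : ℕ := ∏ i, (a i).choose (b i)

open scoped Classical in
/-- The `n`-th Rankin-Cohen bracket `[f, g]_n` of `f` and `g`, where `f` is treated as having
weight `k` and `g` as having weight `l`.  (The truncated subtraction `k i + n i - 1` is
harmless: if `k i = n i = 0` the lower index is `0` and the binomial coefficient is `1`.) -/
def rankinCohen {ι : Type*} [Fintype ι] (k l n : ι → ℕ) (f g : (ι → ℂ) → ℂ) (z : ι → ℂ) : ℂ :=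
  ∑ m ∈ Finset.Icc (0 : ι → ℕ) n,
    (-1 : ℂ) ^ (∑ i, m i) * (multiChoose (k + n - 1) (n - m) : ℂ) *
      (multiChoose (l + n - 1) m : ℂ) * multiDeriv m f z * multiDeriv (n - m) g z

/-! ### Groups -/

set_option linter.unusedSectionVars false

variable {F : Type*} [Field F] [NumberField F]

/-- Total positivity: `a ≫ 0`. -/
def TotallyPos (a : F) : Prop := ∀ σ : F →+* ℝ, 0 < σ a

/-- The different ideal `𝔡` of `F`, as a fractional ideal. -/
def different (F : Type*) [Field F] [NumberField F] : FractionalIdeal (𝓞 F)⁰ F :=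
  (differentIdeal ℤ (𝓞 F) : FractionalIdeal (𝓞 F)⁰ F)

lemma inv_mul_level_le (I : FractionalIdeal (𝓞 F)⁰ F) (𝔫 : Ideal (𝓞 F)) :
    I⁻¹ * (I * (𝔫 : FractionalIdeal (𝓞 F)⁰ F)) ≤ 1 := by
  by_cases h : I = 0
  · simp [h]
  · rw [← mul_assoc, inv_mul_cancel₀ h, one_mul]
    exact FractionalIdeal.coeIdeal_le_one

lemma mul_mem_of_left {I : FractionalIdeal (𝓞 F)⁰ F} {x y : F}
    (hx : x ∈ (1 : FractionalIdeal (𝓞 F)⁰ F)) (hy : y ∈ I) : x * y ∈ I := by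
  have h := FractionalIdeal.mul_mem_mul hx hy
  rwa [one_mul] at h

lemma mul_mem_of_right {I : FractionalIdeal (𝓞 F)⁰ F} {x y : F}
    (hx : x ∈ I) (hy : y ∈ (1 : FractionalIdeal (𝓞 F)⁰ F)) : x * y ∈ I := by
  rw [mul_comm]
  exact mul_mem_of_left hy hx

lemma unit_mul_mem {I : FractionalIdeal (𝓞 F)⁰ F} (u : (𝓞 F)ˣ) {x : F} (hx : x ∈ I) :
    ((u : 𝓞 F) : F) * x ∈ I :=
  mul_mem_of_left (FractionalIdeal.coe_mem_one _ (u : 𝓞 F)) hx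

lemma unit_inv_coe (u : (𝓞 F)ˣ) :
    (((u⁻¹ : (𝓞 F)ˣ) : 𝓞 F) : F) = (((u : 𝓞 F) : F))⁻¹ := by
  refine eq_inv_of_mul_eq_one_left ?_
  rw [← map_mul]
  simp

/-- The congruence subgroup `Γ₀(𝔠, 𝔫)` of matrices `(a, b; c, d)` with `a, d ∈ 𝒪`,
`b ∈ (𝔠𝔡)⁻¹`, `c ∈ 𝔠𝔫𝔡` and `ad - bc` a totally positive unit.
The fractional ideal `1` is the ring of integers `𝒪`. -/
def Gamma0 (𝔠 : FractionalIdeal (𝓞 F)⁰ F) (𝔫 : Ideal (𝓞 F)) : Subgroup (GL (Fin 2) F) where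
  carrier := {g |
    g.1 0 0 ∈ (1 : FractionalIdeal (𝓞 F)⁰ F) ∧
    g.1 0 1 ∈ (𝔠 * different F)⁻¹ ∧
    g.1 1 0 ∈ 𝔠 * different F * (𝔫 : FractionalIdeal (𝓞 F)⁰ F) ∧
    g.1 1 1 ∈ (1 : FractionalIdeal (𝓞 F)⁰ F) ∧
    ∃ u : (𝓞 F)ˣ, TotallyPos ((u : 𝓞 F) : F) ∧ g.1.det = ((u : 𝓞 F) : F)}
  one_mem' := by
    refine ⟨?_, ?_, ?_, ?_, 1, ?_, ?_⟩
    · simp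
    · simpa using FractionalIdeal.zero_mem _
    · simpa using FractionalIdeal.zero_mem _
    · simp
    · intro σ; simp
    · simp
  mul_mem' := by
    rintro g h ⟨ga, gb, gc, gd, u, hu, gu⟩ ⟨ha, hb, hc, hd, v, hv, hv'⟩
    have key := inv_mul_level_le (𝔠 * different F) 𝔫
    simp only [Set.mem_ofPred_eq, Units.val_mul, Matrix.mul_apply, Fin.sum_univ_two]
    refine ⟨?_, ?_, ?_, ?_, u * v, ?_, ?_⟩
    · refine Submodule.add_mem _ ?_ (key (FractionalIdeal.mul_mem_mul gb hc))
      exact mul_mem_of_left ga ha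
    · refine Submodule.add_mem _ ?_ ?_
      · exact mul_mem_of_left ga hb
      · exact mul_mem_of_right gb hd
    · refine Submodule.add_mem _ ?_ ?_
      · exact mul_mem_of_right gc ha
      · exact mul_mem_of_left gd hc
    · refine Submodule.add_mem _ ?_ ?_
      · refine key ?_
        rw [mul_comm (g.1 1 0)]
        exact FractionalIdeal.mul_mem_mul hb gc
      · exact mul_mem_of_left gd hd
    · intro σ
      simpa using mul_pos (hu σ) (hv σ)
    · simp [gu, hv']
  inv_mem' := by
    rintro g ⟨ga, gb, gc, gd, u, hu, gu⟩
    have e : ((g⁻¹ : GL (Fin 2) F) : Matrix (Fin 2) (Fin 2) F) =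
        (((u⁻¹ : (𝓞 F)ˣ) : 𝓞 F) : F) • !![g.1 1 1, -g.1 0 1; -g.1 1 0, g.1 0 0] := by
      rw [Matrix.coe_units_inv, Matrix.inv_def, Matrix.adjugate_fin_two, gu, unit_inv_coe]
      simp
    have hdet : ((g⁻¹ : GL (Fin 2) F) : Matrix (Fin 2) (Fin 2) F).det =
        (((u⁻¹ : (𝓞 F)ˣ) : 𝓞 F) : F) := by
      rw [unit_inv_coe, ← gu, Matrix.coe_units_inv, Matrix.det_nonsing_inv, Ring.inverse_eq_inv']
    refine ⟨?_, ?_, ?_, ?_, u⁻¹, ?_, hdet⟩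
    · rw [e]; simpa using unit_mul_mem u⁻¹ gd
    · rw [e]; simpa using unit_mul_mem u⁻¹ (Submodule.neg_mem _ gb)
    · rw [e]; simpa using unit_mul_mem u⁻¹ (Submodule.neg_mem _ gc)
    · rw [e]; simpa using unit_mul_mem u⁻¹ ga
    · intro σ
      rw [unit_inv_coe, map_inv₀]
      exact inv_pos.mpr (hu σ)

/-- The parabolic subgroup `Γ_∞ = U(Γ) Z(Γ) N(Γ)`: products of `diag(ε, 1)` with `ε` a totally
positive unit, `diag(η, η)` with `η` a unit, and `(1, b; 0, 1)` with `b ∈ (𝔠𝔡)⁻¹`. -/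
def GammaInf (𝔠 : FractionalIdeal (𝓞 F)⁰ F) : Subgroup (GL (Fin 2) F) where
  carrier := {g | ∃ ε η : (𝓞 F)ˣ, TotallyPos ((ε : 𝓞 F) : F) ∧ ∃ b ∈ (𝔠 * different F)⁻¹,
    (g : Matrix (Fin 2) (Fin 2) F) =
      !![((ε : 𝓞 F) : F), 0; 0, 1] * !![((η : 𝓞 F) : F), 0; 0, ((η : 𝓞 F) : F)] * !![1, b; 0, 1]}
  one_mem' := by
    refine ⟨1, 1, fun σ => by simp, 0, FractionalIdeal.zero_mem _, ?_⟩
    simp [Matrix.one_fin_two]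
  mul_mem' := by
    rintro g h ⟨ε, η, hε, b, hb, hg⟩ ⟨ε', η', hε', b', hb', hh⟩
    refine ⟨ε * ε', η * η', fun σ => by simpa using mul_pos (hε σ) (hε' σ),
      b' + (((ε'⁻¹ : (𝓞 F)ˣ) : 𝓞 F) : F) * b, Submodule.add_mem _ hb' (unit_mul_mem _ hb), ?_⟩
    have hne : ((ε' : 𝓞 F) : F) ≠ 0 := by simp
    have hm : ∀ x y : (𝓞 F)ˣ, (((x * y : (𝓞 F)ˣ) : 𝓞 F) : F) = ((x : 𝓞 F) : F) * ((y : 𝓞 F) : F) :=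
      fun x y => by simp
    rw [Units.val_mul, hg, hh, unit_inv_coe, hm, hm]
    generalize ((ε : 𝓞 F) : F) = e at *
    generalize ((η : 𝓞 F) : F) = t at *
    generalize ((ε' : 𝓞 F) : F) = e' at *
    generalize ((η' : 𝓞 F) : F) = t' at *
    ext i j
    fin_cases i <;> fin_cases j <;> simp <;> field_simp <;> ring
  inv_mem' := by
    rintro g ⟨ε, η, hε, b, hb, hg⟩
    refine ⟨ε⁻¹, η⁻¹, fun σ => ?_, -(((ε : (𝓞 F)ˣ) : 𝓞 F) : F) * b, ?_, ?_⟩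
    · rw [unit_inv_coe, map_inv₀]
      exact inv_pos.mpr (hε σ)
    · rw [neg_mul]
      exact Submodule.neg_mem _ (unit_mul_mem _ hb)
    · have h1 : ((ε : 𝓞 F) : F) ≠ 0 := by simp
      have h2 : ((η : 𝓞 F) : F) ≠ 0 := by simp
      rw [Matrix.coe_units_inv, unit_inv_coe, unit_inv_coe]
      refine Matrix.inv_eq_right_inv ?_
      rw [hg]
      generalize ((ε : 𝓞 F) : F) = e at *
      generalize ((η : 𝓞 F) : F) = t at *
      ext i j
      fin_cases i <;> fin_cases j <;> simp <;> field_simp <;> ring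

/-- The coset space `Γ_∞ \ Γ` with `Γ = Γ₀(𝔠, 𝔫)`. -/
abbrev Cosets (𝔠 : FractionalIdeal (𝓞 F)⁰ F) (𝔫 : Ideal (𝓞 F)) : Type _ :=
  Quotient (QuotientGroup.rightRel ((GammaInf 𝔠).subgroupOf (Gamma0 𝔠 𝔫)))

/-- A representative in `Γ` of a coset in `Γ_∞ \ Γ`. -/
def Cosets.rep {𝔠 : FractionalIdeal (𝓞 F)⁰ F} {𝔫 : Ideal (𝓞 F)} (q : Cosets 𝔠 𝔫) :
    GL (Fin 2) F :=
  ((Quotient.out q : Gamma0 𝔠 𝔫) : GL (Fin 2) F)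

/-! ### Hilbert modular forms

The coordinates of `ℍ^d` are indexed by the `d` real embeddings `σ : F →+* ℝ`. -/

/-- The componentwise Möbius transformation. -/
def moebius (g : GL (Fin 2) F) (z : (F →+* ℝ) → ℂ) : (F →+* ℝ) → ℂ := fun σ =>
  ((σ (g.1 0 0) : ℂ) * z σ + (σ (g.1 0 1) : ℂ)) / ((σ (g.1 1 0) : ℂ) * z σ + (σ (g.1 1 1) : ℂ))

/-- The slash action `(f |_k g)(z) = det(g)^(k/2) N(cz + d)^(-k) f(g z)`
for `g` of totally positive determinant. -/
def slash (k : (F →+* ℝ) → ℕ) (g : GL (Fin 2) F) (f : ((F →+* ℝ) → ℂ) → ℂ)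
    (z : (F →+* ℝ) → ℂ) : ℂ :=
  (∏ σ : F →+* ℝ, (((σ g.1.det) ^ ((k σ : ℝ) / 2) : ℝ) : ℂ) *
    (((σ (g.1 1 0) : ℂ) * z σ + (σ (g.1 1 1) : ℂ)) ^ (k σ))⁻¹) * f (moebius g z)

/-- `e(ν z) = exp(2 π i Tr(ν z))`. -/
def qExp (ν : F) (z : (F →+* ℝ) → ℂ) : ℂ :=
  Complex.exp (2 * Real.pi * Complex.I * ∑ σ : F →+* ℝ, (σ ν : ℂ) * z σ)

/-- The index set `𝔠⁺ ∪ {0}`. -/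
def posOrZero (𝔠 : FractionalIdeal (𝓞 F)⁰ F) : Set F :=
  {ν | ν ∈ 𝔠 ∧ TotallyPos ν} ∪ {0}

/-- The q-series `∑_{ν ∈ 𝔠⁺ ∪ {0}} a(ν) e(ν z)`. -/
def qSeries (𝔠 : FractionalIdeal (𝓞 F)⁰ F) (a : F → ℂ) (z : (F →+* ℝ) → ℂ) : ℂ :=
  ∑' ν : posOrZero 𝔠, a ν * qExp (ν : F) z

/-- `f ∈ M_k(Γ₀(𝔠, 𝔫))`: `f` is holomorphic on `ℍ^d` and `f |_k γ = f` for `γ ∈ Γ₀(𝔠, 𝔫)`. (For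
`d > 1` no condition at the cusps is needed.) -/
structure IsHilbertModularForm (𝔠 : FractionalIdeal (𝓞 F)⁰ F) (𝔫 : Ideal (𝓞 F))
    (k : (F →+* ℝ) → ℕ) (f : ((F →+* ℝ) → ℂ) → ℂ) : Prop where
  holo : DifferentiableOn ℂ f (upperHalfSpace (F →+* ℝ))
  slash_eq : ∀ γ ∈ Gamma0 𝔠 𝔫, ∀ z ∈ upperHalfSpace (F →+* ℝ), slash k γ f z = f z

/-- Cusp forms: at every cusp, i.e. for every `g ∈ GL₂⁺(F)`, the Fourier expansion of `f |_k g`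
(over the totally positive elements, and `0`, of some fractional ideal) has constant term `0`. -/
structure IsCuspForm (𝔠 : FractionalIdeal (𝓞 F)⁰ F) (𝔫 : Ideal (𝓞 F))
    (k : (F →+* ℝ) → ℕ) (f : ((F →+* ℝ) → ℂ) → ℂ) : Prop
    extends IsHilbertModularForm 𝔠 𝔫 k f where
  cusps : ∀ g : GL (Fin 2) F, TotallyPos g.1.det →
    ∃ 𝔞 : FractionalIdeal (𝓞 F)⁰ F, ∃ a : F → ℂ, a 0 = 0 ∧
      ∀ z ∈ upperHalfSpace (F →+* ℝ),
        HasSum (fun ν : posOrZero 𝔞 => a ν * qExp (ν : F) z) (slash k g f z)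

/-- The terms `φ |_k M (z)`, `M ∈ Γ_∞ \ Γ`, of the Poincaré series of weight `k`. For a seed `φ`
that is invariant under `Γ_∞` in weight `k` they do not depend on the representatives. -/
def poincareTerm (𝔠 : FractionalIdeal (𝓞 F)⁰ F) (𝔫 : Ideal (𝓞 F)) (k : (F →+* ℝ) → ℕ)
    (φ : ((F →+* ℝ) → ℂ) → ℂ) (z : (F →+* ℝ) → ℂ) (M : Cosets 𝔠 𝔫) : ℂ :=
  slash k M.rep φ z

/-- The Hilbert Poincaré series `ℙ_k(φ; z) = ∑_{M ∈ Γ_∞ \ Γ} (φ |_k M)(z)`. -/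
def poincare (𝔠 : FractionalIdeal (𝓞 F)⁰ F) (𝔫 : Ideal (𝓞 F)) (k : (F →+* ℝ) → ℕ)
    (φ : ((F →+* ℝ) → ℂ) → ℂ) (z : (F →+* ℝ) → ℂ) : ℂ :=
  ∑' M : Cosets 𝔠 𝔫, poincareTerm 𝔠 𝔫 k φ z M

/-- Invariance of a seed function under `Γ_∞` in weight `k`. -/
def IsGammaInfInvariant (𝔠 : FractionalIdeal (𝓞 F)⁰ F) (k : (F →+* ℝ) → ℕ)
    (φ : ((F →+* ℝ) → ℂ) → ℂ) : Prop :=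
  ∀ γ ∈ GammaInf 𝔠, ∀ z ∈ upperHalfSpace (F →+* ℝ), slash k γ φ z = φ z

/-- The growth condition `a(ν) = O(N(ν)^(l/2 - 2 - ε))` on `𝔠⁺`, where
`N(ν)^s = ∏ σ, σ(ν)^(s σ)`. -/
def CoeffBound (𝔠 : FractionalIdeal (𝓞 F)⁰ F) (l : (F →+* ℝ) → ℕ) (ε : ℝ) (a : F → ℂ) : Prop :=
  ∃ C : ℝ, ∀ ν ∈ 𝔠, TotallyPos ν →
    ‖a ν‖ ≤ C * ∏ σ : F →+* ℝ, (σ ν) ^ ((l σ : ℝ) / 2 - 2 - ε)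

end

end HilbertPoincare

open HilbertPoincare

/-! ### Holomorphic functions of several variables -/

set_option linter.unusedSectionVars false

section SeveralVariables

open Metric Filter Topology

variable {E : Type*} [NormedAddCommGroup E] [NormedSpace ℂ E]

/-! Write φ for the q-series and `M` for representatives of `Γ_∞ \ Γ`, so that the Poincaré series
of weight `l` is `∑ φ|_l M`. Two facts give the theorem.

Equivariance (`rankinCohen_slash`): `[f|_k M, φ|_l M]_n = [f, φ]_n |_{k+l+2n} M`. Since `f|_k M =
f`, the term of the right-hand series at `M` is `[f, φ|_l M]_n`. The derivatives of a slashed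
function are combinations of derivatives at `M z` with coefficients that factor over the variables
(`multiDeriv_slash`). Hence everything reduces to one variable (`sum_slashDerivFactor_mul`), where
the coefficient of `g^(r) h^(s)` is a multiple of `(1 - 1)^(n-r-s)` when `r + s < n`, has no terms
when `r + s > n`, and is the expected one when `r + s = n`.

Normal convergence (`normallySummable_slash_rep`): near each point of the domain the terms `φ|_l M`
have a summable majorant. By Cauchy's estimates this passes to all derivatives, so the bracket with
`f`, which at a given point involves only finitely many numbers `f^(m)(z)`, may be formed term by
term (`hasSum_rankinCohen`). This yields the convergence of the second series as well as the
identity.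

For the majorant, Dirichlet's unit theorem provides each coset with a representative of determinant
one whose vector `(σ(c) i + σ(d))_σ` has entries of comparable size, say of maximum `T`
(`exists_balanced_rep`). Then all imaginary parts of `M z` are at least a constant times `T^(-2)`.
The coefficient bound gives `|φ(w)| ≪ Y^(-S)`, with `S = ∑ (l_σ/2 - 1 - ε/2)`, whenever all
imaginary parts of `w` are at least `Y` and `Y ≤ 1` (`exists_norm_qSeries_le`); behind it is a count
of the lattice points in boxes (`exists_card_le_prod`). So the term is `≪ T^(-∑ l_σ + 2S) =
T^(-d(2+ε))`. Different cosets have different rows `(c, d)`, which lie in a lattice in a real space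
of dimension `2d`, so the sum converges. -/

lemma norm_fderiv_le_of_forall_ball {f : E → ℂ} {x : E} {R C : ℝ} (hR : 0 < R)
    (hf : DifferentiableOn ℂ f (ball x R)) (hC : ∀ y ∈ ball x R, ‖f y‖ ≤ C) :
    ‖fderiv ℂ f x‖ ≤ 2 * C / R := by
  refine Complex.norm_fderiv_le_div_of_mapsTo_ball hf (fun y hy => ?_) hR
  rw [mem_closedBall, dist_eq_norm]
  linarith [norm_sub_le (f y) (f x), hC y hy, hC x (mem_ball_self hR)]

/-- Cauchy's formula on the complex line through `x` in direction `v`. The circle does not depend on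
`x`, so the right side can be differentiated in `x` under the integral sign. -/
lemma fderiv_apply_eq_circleIntegral {f : E → ℂ} {x v : E} {R ρ : ℝ}
    (hf : DifferentiableOn ℂ f (ball x R)) (hρ : 0 < ρ) (hv : ρ * ‖v‖ < R) :
    fderiv ℂ f x v =
      (2 * Real.pi * Complex.I)⁻¹ * ∮ t in C(0, ρ), (t ^ 2)⁻¹ * f (x + t • v) := by
  have hR : 0 < R := (by positivity : 0 ≤ ρ * ‖v‖).trans_lt hv
  set U : Set ℂ := (fun t : ℂ => x + t • v) ⁻¹' ball x R
  have hc : Continuous fun t : ℂ => x + t • v := by fun_prop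
  have hU : IsOpen U := isOpen_ball.preimage hc
  have hg : DifferentiableOn ℂ (fun t : ℂ => f (x + t • v)) U :=
    hf.comp (by fun_prop) fun t ht => ht
  have hsub : closedBall (0 : ℂ) ρ ⊆ U := by
    intro t ht
    rw [mem_closedBall, dist_zero_right] at ht
    simp only [U, Set.mem_preimage, mem_ball, dist_self_add_left, norm_smul]
    exact (mul_le_mul_of_nonneg_right ht (norm_nonneg v)).trans_lt hv
  have key := Complex.two_pi_I_inv_smul_circleIntegral_sub_sq_inv_smul_of_differentiable hU hsub hg
    (mem_ball_self hρ)
  simp only [sub_zero, smul_eq_mul] at key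
  rw [key]
  have hfx : HasFDerivAt f (fderiv ℂ f x) (x + (0 : ℂ) • v) := by
    simpa using (hf.differentiableAt (ball_mem_nhds x hR)).hasFDerivAt
  have h1 : HasDerivAt (fun t : ℂ => x + t • v) v 0 := by
    simpa using ((hasDerivAt_id (0 : ℂ)).smul_const v).const_add x
  exact ((hfx.comp_hasDerivAt (0 : ℂ) h1).deriv).symm

/-- A directional derivative of a holomorphic function is holomorphic. -/
lemma DifferentiableOn.fderiv_apply_complex [MeasurableSpace E] [BorelSpace E]
    [SecondCountableTopology (E →L[ℂ] ℂ)] {f : E → ℂ} {U : Set E}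
    (hf : DifferentiableOn ℂ f U) (hU : IsOpen U) (v : E) :
    DifferentiableOn ℂ (fun x => fderiv ℂ f x v) U := by
  intro x₀ hx₀
  obtain ⟨R, hR, C, hRU, hC⟩ : ∃ R > 0, ∃ C, ball x₀ R ⊆ U ∧ ∀ y ∈ ball x₀ R, ‖f y‖ ≤ C := by
    have h1 : ∀ᶠ y in 𝓝 x₀, ‖f y‖ < ‖f x₀‖ + 1 :=
      ((hf.differentiableAt (hU.mem_nhds hx₀)).continuousAt.norm).eventually_lt_const (by linarith)
    obtain ⟨R, hR, h⟩ := Metric.eventually_nhds_iff_ball.1 (h1.and (hU.mem_nhds hx₀))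
    exact ⟨R, hR, _, fun y hy => (h y hy).2, fun y hy => (h y hy).1.le⟩
  -- With this radius, circles around points of the ball of radius `R / 4` stay in the ball of
  -- radius `R / 2`, where Cauchy's estimate still has room `R / 2`. The `+ 1` covers `v = 0`.
  set ρ : ℝ := R / (4 * (‖v‖ + 1)) with hρdef
  have hv0 := norm_nonneg v
  have hρ : 0 < ρ := by positivity
  have hρv : ρ * ‖v‖ < R / 4 := by
    rw [hρdef, div_mul_eq_mul_div, div_lt_div_iff₀ (by positivity) (by norm_num)]
    nlinarith
  have hmem : ∀ x ∈ ball x₀ (R / 4), ∀ θ : ℝ, x + circleMap 0 ρ θ • v ∈ ball x₀ (R / 2) := by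
    intro x hx θ
    rw [mem_ball, dist_eq_norm] at hx ⊢
    have : ‖circleMap 0 ρ θ • v‖ = ρ * ‖v‖ := by simp [norm_smul, abs_of_pos hρ]
    calc ‖x + circleMap 0 ρ θ • v - x₀‖ = ‖(x - x₀) + circleMap 0 ρ θ • v‖ := by congr 1; abel
      _ ≤ ‖x - x₀‖ + ρ * ‖v‖ := (norm_add_le _ _).trans_eq (by rw [this])
      _ < R / 2 := by linarith
  have hderiv : ∀ y ∈ ball x₀ (R / 2), ‖fderiv ℂ f y‖ ≤ 2 * C / (R / 2) := by
    intro y hy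
    have hsub : ball y (R / 2) ⊆ ball x₀ R := by
      refine ball_subset_ball' ?_
      rw [mem_ball] at hy; linarith
    exact norm_fderiv_le_of_forall_ball (by positivity) (hf.mono (hsub.trans hRU))
      fun z hz => hC z (hsub hz)
  set w : ℝ → ℂ := fun θ => _root_.deriv (circleMap 0 ρ) θ * ((circleMap 0 ρ θ) ^ 2)⁻¹ with hw
  have hwc : Continuous w := by
    have : ∀ θ, circleMap 0 ρ θ ^ 2 ≠ 0 := fun θ => pow_ne_zero _ (circleMap_ne_center hρ.ne')
    simp only [hw, deriv_circleMap]
    fun_prop (disch := assumption)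
  have hfc : ContinuousOn f (ball x₀ (R / 2)) :=
    (hf.mono ((ball_subset_ball (by linarith)).trans hRU)).continuousOn
  have hFc : ∀ x ∈ ball x₀ (R / 4), Continuous fun θ : ℝ => w θ * f (x + circleMap 0 ρ θ • v) :=
    fun x hx => hwc.mul (hfc.comp_continuous (by fun_prop) (hmem x hx))
  have hmain := intervalIntegral.hasFDerivAt_integral_of_dominated_of_fderiv_le
    (𝕜 := ℂ) (μ := MeasureTheory.volume) (a := 0) (b := 2 * Real.pi)
    (F := fun x θ => w θ * f (x + circleMap 0 ρ θ • v))
    (F' := fun x θ => w θ • fderiv ℂ f (x + circleMap 0 ρ θ • v))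
    (bound := fun θ => ‖w θ‖ * (2 * C / (R / 2))) (x₀ := x₀) (s := ball x₀ (R / 4))
    (ball_mem_nhds _ (by positivity)) ?_ ?_ ?_ ?_ ?_ ?_
  · refine DifferentiableAt.differentiableWithinAt ?_
    refine ((hmain.differentiableAt.const_mul (2 * Real.pi * Complex.I)⁻¹)).congr_of_eventuallyEq ?_
    filter_upwards [ball_mem_nhds x₀ (by positivity : 0 < R / 4)] with x hx
    have hsub : ball x (R / 4) ⊆ U := by
      refine (ball_subset_ball' ?_).trans hRU
      rw [mem_ball] at hx; linarith
    rw [fderiv_apply_eq_circleIntegral (hf.mono hsub) hρ hρv, circleIntegral]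
    simp only [hw, smul_eq_mul, mul_assoc]
  · filter_upwards [ball_mem_nhds x₀ (by positivity : 0 < R / 4)] with x hx
    exact (hFc x hx).aestronglyMeasurable
  · exact (hFc x₀ (mem_ball_self (by positivity))).intervalIntegrable _ _
  -- Continuity of `fderiv ℂ f` is not yet known at this point; measurability suffices for
  -- domination.
  · refine (hwc.measurable.smul ((measurable_fderiv ℂ f).comp ?_)).aestronglyMeasurable
    exact Continuous.measurable (by fun_prop)
  · refine Eventually.of_forall fun θ _ x hx => ?_
    rw [norm_smul]
    exact mul_le_mul_of_nonneg_left (hderiv _ (hmem x hx θ)) (norm_nonneg _)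
  · exact (hwc.norm.mul_const _).intervalIntegrable _ _
  · refine Eventually.of_forall fun θ _ x hx => ?_
    have hd : HasFDerivAt f (fderiv ℂ f (x + circleMap 0 ρ θ • v)) (x + circleMap 0 ρ θ • v) := by
      refine (hf.differentiableAt (hU.mem_nhds (hRU ?_))).hasFDerivAt
      exact ball_subset_ball (by linarith) (hmem x hx θ)
    exact ((hasFDerivAt_comp_add_right (circleMap 0 ρ θ • v)).2 hd).const_mul (w θ)

variable {ι : Type*} [Fintype ι]

lemma isOpen_upperHalfSpace : IsOpen (upperHalfSpace ι) := by
  simp only [upperHalfSpace, Set.ofPred_forall]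
  exact isOpen_iInter_of_finite fun i =>
    isOpen_lt continuous_const (Complex.continuous_im.comp (continuous_apply i))

open scoped Classical in
lemma partialDeriv_eq_fderiv {f : (ι → ℂ) → ℂ} {z : ι → ℂ} (hf : DifferentiableAt ℂ f z) (i : ι) :
    partialDeriv i f z = fderiv ℂ f z (Pi.single i 1) := by
  have h : HasFDerivAt f (fderiv ℂ f z) (Function.update z i (z i)) := by
    simpa using hf.hasFDerivAt
  have := (h.comp_hasDerivAt (z i) (hasDerivAt_update z i (z i))).deriv
  unfold partialDeriv
  convert! this

open scoped Classical in
lemma norm_partialDeriv_le {f : (ι → ℂ) → ℂ} {z : ι → ℂ} {R C : ℝ} (hR : 0 < R)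
    (hf : DifferentiableOn ℂ f (ball z R)) (hC : ∀ y ∈ ball z R, ‖f y‖ ≤ C) (i : ι) :
    ‖partialDeriv i f z‖ ≤ 2 * C / R := by
  rw [partialDeriv_eq_fderiv (hf.differentiableAt (ball_mem_nhds z hR))]
  refine ((fderiv ℂ f z).le_opNorm _).trans ?_
  rw [Pi.norm_single, norm_one, mul_one]
  exact norm_fderiv_le_of_forall_ball hR hf hC

lemma DifferentiableOn.partialDeriv {f : (ι → ℂ) → ℂ} {U : Set (ι → ℂ)}
    (hf : DifferentiableOn ℂ f U) (hU : IsOpen U) (i : ι) :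
    DifferentiableOn ℂ (partialDeriv i f) U := by
  classical
  exact (hf.fderiv_apply_complex hU (Pi.single i 1)).congr fun z hz =>
    partialDeriv_eq_fderiv (hf.differentiableAt (hU.mem_nhds hz)) i

lemma partialDeriv_congr {f g : (ι → ℂ) → ℂ} {U : Set (ι → ℂ)} (hU : IsOpen U)
    (h : Set.EqOn f g U) (i : ι) : Set.EqOn (partialDeriv i f) (partialDeriv i g) U := by
  classical
  intro z hz
  unfold HilbertPoincare.partialDeriv
  refine EventuallyEq.deriv_eq ?_
  have hc : Continuous fun t : ℂ => Function.update z i t := continuous_const.update i continuous_id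
  have : (fun t : ℂ => Function.update z i t) ⁻¹' U ∈ 𝓝 (z i) :=
    hc.continuousAt.preimage_mem_nhds (hU.mem_nhds (by simpa using hz))
  filter_upwards [this] with t ht
  convert! h ht

/-- The family `g` of functions is normally summable on `U`: each point of `U` has a ball around it
in `U` on which the norms of the `g q` are bounded by a summable family. -/
def NormallySummable {Q : Type*} (g : Q → (ι → ℂ) → ℂ) (U : Set (ι → ℂ)) : Prop :=
  ∀ x ∈ U, ∃ R > 0, ball x R ⊆ U ∧ ∃ u : Q → ℝ, Summable u ∧ ∀ q, ∀ y ∈ ball x R, ‖g q y‖ ≤ u q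

namespace NormallySummable

variable {Q : Type*} {g : Q → (ι → ℂ) → ℂ} {U : Set (ι → ℂ)}

lemma summable_norm (h : NormallySummable g U) {z : ι → ℂ} (hz : z ∈ U) :
    Summable fun q => ‖g q z‖ := by
  obtain ⟨R, hR, -, u, hu, hb⟩ := h z hz
  exact hu.of_nonneg_of_le (fun q => norm_nonneg _) fun q => hb q z (mem_ball_self hR)

/-- On the ball of half the radius, Cauchy's estimate turns the majorant `u` of the functions into
the summable majorant `4 u / R` of their derivatives. -/
lemma hasFDerivAt_tsum (h : NormallySummable g U) (hg : ∀ q, DifferentiableOn ℂ (g q) U)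
    {z : ι → ℂ} (hz : z ∈ U) :
    Summable (fun q => fderiv ℂ (g q) z) ∧
      HasFDerivAt (fun y => ∑' q, g q y) (∑' q, fderiv ℂ (g q) z) z := by
  obtain ⟨R, hR, hRU, u, hu, hb⟩ := h z hz
  have hbound : ∀ q, ∀ y ∈ ball z (R / 2), ‖fderiv ℂ (g q) y‖ ≤ 2 * u q / (R / 2) := by
    intro q y hy
    have hsub : ball y (R / 2) ⊆ ball z R := by
      refine ball_subset_ball' ?_
      rw [mem_ball] at hy; linarith
    exact norm_fderiv_le_of_forall_ball (by positivity) ((hg q).mono (hsub.trans hRU))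
      fun w hw => hb q w (hsub hw)
  have hu' : Summable fun q => 2 * u q / (R / 2) := (hu.mul_left 2).div_const _
  have hz' : z ∈ ball z (R / 2) := mem_ball_self (by positivity)
  refine ⟨.of_norm_bounded hu' fun q => hbound q z hz', ?_⟩
  refine hasFDerivAt_tsum_of_isPreconnected hu' isOpen_ball
    (convex_ball z (R / 2)).isPreconnected (fun q y hy => ?_) hbound hz'
    (h.summable_norm hz).of_norm hz'
  refine ((hg q).differentiableAt ?_).hasFDerivAt
  exact Filter.mem_of_superset (isOpen_ball.mem_nhds hy)
    ((ball_subset_ball (by linarith)).trans hRU)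

lemma differentiableOn_tsum (h : NormallySummable g U) (hg : ∀ q, DifferentiableOn ℂ (g q) U) :
    DifferentiableOn ℂ (fun y => ∑' q, g q y) U := fun _ hz =>
  (h.hasFDerivAt_tsum hg hz).2.differentiableAt.differentiableWithinAt

/-- Stability under differentiation is what allows termwise differentiation to be iterated. -/
lemma partialDeriv (h : NormallySummable g U) (hg : ∀ q, DifferentiableOn ℂ (g q) U) (i : ι) :
    NormallySummable (fun q => partialDeriv i (g q)) U := by
  intro z hz
  obtain ⟨R, hR, hRU, u, hu, hb⟩ := h z hz
  refine ⟨R / 2, by positivity, (ball_subset_ball (by linarith)).trans hRU,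
    fun q => 2 * u q / (R / 2), (hu.mul_left 2).div_const _, fun q y hy => ?_⟩
  have hsub : ball y (R / 2) ⊆ ball z R := by
    refine ball_subset_ball' ?_
    rw [mem_ball] at hy; linarith
  exact norm_partialDeriv_le (by positivity) ((hg q).mono (hsub.trans hRU))
    (fun w hw => hb q w (hsub hw)) i

lemma partialDeriv_tsum (h : NormallySummable g U) (hU : IsOpen U)
    (hg : ∀ q, DifferentiableOn ℂ (g q) U) (i : ι) :
    Set.EqOn (HilbertPoincare.partialDeriv i fun y => ∑' q, g q y)
      (fun y => ∑' q, HilbertPoincare.partialDeriv i (g q) y) U := by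
  classical
  intro z hz
  obtain ⟨hs, hd⟩ := h.hasFDerivAt_tsum hg hz
  rw [partialDeriv_eq_fderiv hd.differentiableAt, hd.fderiv]
  have := (ContinuousLinearMap.apply ℂ ℂ (Pi.single i (1 : ℂ) : ι → ℂ)).map_tsum hs
  simp only [ContinuousLinearMap.apply_apply] at this
  rw [this]
  exact tsum_congr fun q =>
    (partialDeriv_eq_fderiv ((hg q).differentiableAt (hU.mem_nhds hz)) i).symm

end NormallySummable

/-- The mixed derivative along the variables in a list. -/
noncomputable def listDeriv (L : List ι) (m : ι → ℕ) (f : (ι → ℂ) → ℂ) : (ι → ℂ) → ℂ :=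
  L.foldr (fun i g => (partialDeriv i)^[m i] g) f

/-- Arbitrary lists in place of `Finset.univ.toList` permit induction on the variables. -/
lemma multiDeriv_eq_listDeriv (m : ι → ℕ) (f : (ι → ℂ) → ℂ) :
    multiDeriv m f = listDeriv Finset.univ.toList m f := rfl

section Iterate

variable {U : Set (ι → ℂ)}

lemma DifferentiableOn.iterate_partialDeriv {f : (ι → ℂ) → ℂ} (hf : DifferentiableOn ℂ f U)
    (hU : IsOpen U) (i : ι) (m : ℕ) :
    DifferentiableOn ℂ ((HilbertPoincare.partialDeriv i)^[m] f) U := by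
  induction m with
  | zero => exact hf
  | succ m ih =>
    rw [Function.iterate_succ_apply']
    exact ih.partialDeriv hU i

lemma DifferentiableOn.listDeriv {f : (ι → ℂ) → ℂ} (hf : DifferentiableOn ℂ f U)
    (hU : IsOpen U) (L : List ι) (m : ι → ℕ) : DifferentiableOn ℂ (listDeriv L m f) U := by
  induction L with
  | nil => exact hf
  | cons i L ih => exact ih.iterate_partialDeriv hU i (m i)

lemma iterate_partialDeriv_congr {f g : (ι → ℂ) → ℂ} (hU : IsOpen U) (h : Set.EqOn f g U) (i : ι)
    (m : ℕ) : Set.EqOn ((partialDeriv i)^[m] f) ((partialDeriv i)^[m] g) U := by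
  induction m with
  | zero => exact h
  | succ m ih =>
    rw [Function.iterate_succ_apply', Function.iterate_succ_apply']
    exact partialDeriv_congr hU ih i

lemma listDeriv_congr {f g : (ι → ℂ) → ℂ} (hU : IsOpen U) (h : Set.EqOn f g U) (L : List ι)
    (m : ι → ℕ) : Set.EqOn (listDeriv L m f) (listDeriv L m g) U := by
  induction L with
  | nil => exact h
  | cons i L ih => exact iterate_partialDeriv_congr hU ih i (m i)

lemma multiDeriv_congr {f g : (ι → ℂ) → ℂ} (hU : IsOpen U) (h : Set.EqOn f g U)
    (m : ι → ℕ) : Set.EqOn (multiDeriv m f) (multiDeriv m g) U :=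
  listDeriv_congr hU h _ m

variable {Q : Type*} {g : Q → (ι → ℂ) → ℂ}

lemma NormallySummable.iterate_partialDeriv (h : NormallySummable g U) (hU : IsOpen U)
    (hg : ∀ q, DifferentiableOn ℂ (g q) U) (i : ι) (m : ℕ) :
    NormallySummable (fun q => (HilbertPoincare.partialDeriv i)^[m] (g q)) U ∧
    Set.EqOn ((HilbertPoincare.partialDeriv i)^[m] fun y => ∑' q, g q y)
      (fun y => ∑' q, (HilbertPoincare.partialDeriv i)^[m] (g q) y) U := by
  induction m with
  | zero => exact ⟨h, fun _ _ => rfl⟩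
  | succ m ih =>
    simp only [Function.iterate_succ_apply']
    have hd := fun q => (hg q).iterate_partialDeriv hU i m
    exact ⟨ih.1.partialDeriv hd i,
      (partialDeriv_congr hU ih.2 i).trans (ih.1.partialDeriv_tsum hU hd i)⟩

lemma NormallySummable.listDeriv (h : NormallySummable g U) (hU : IsOpen U)
    (hg : ∀ q, DifferentiableOn ℂ (g q) U) (L : List ι) (m : ι → ℕ) :
    NormallySummable (fun q => listDeriv L m (g q)) U ∧
    Set.EqOn (_root_.listDeriv L m fun y => ∑' q, g q y)
      (fun y => ∑' q, _root_.listDeriv L m (g q) y) U := by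
  induction L with
  | nil => exact ⟨h, fun _ _ => rfl⟩
  | cons i L ih =>
    have hd := fun q => (hg q).listDeriv hU L m
    have := ih.1.iterate_partialDeriv hU hd i (m i)
    exact ⟨this.1, (iterate_partialDeriv_congr hU ih.2 i (m i)).trans this.2⟩

lemma NormallySummable.multiDeriv (h : NormallySummable g U) (hU : IsOpen U)
    (hg : ∀ q, DifferentiableOn ℂ (g q) U) (m : ι → ℕ) :
    NormallySummable (fun q => multiDeriv m (g q)) U ∧
    Set.EqOn (HilbertPoincare.multiDeriv m fun y => ∑' q, g q y)
      (fun y => ∑' q, HilbertPoincare.multiDeriv m (g q) y) U :=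
  h.listDeriv hU hg _ m

end Iterate

end SeveralVariables

/-! ### Derivatives of slashed functions -/

/-- The coefficients `(m choose r) (k + r) (k + r + 1) ⋯ (k + m - 1)` in the formula for the `m`-th
derivative of a function slashed in weight `k`. -/
def slashDerivCoeff (k m r : ℕ) : ℕ := m.choose r * (k + r).ascFactorial (m - r)

lemma slashDerivCoeff_eq_zero {k m r : ℕ} (h : m < r) : slashDerivCoeff k m r = 0 := by
  simp [slashDerivCoeff, Nat.choose_eq_zero_of_lt h]

lemma slashDerivCoeff_self (k m : ℕ) : slashDerivCoeff k m m = 1 := by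
  simp [slashDerivCoeff]

lemma slashDerivCoeff_succ_zero (k m : ℕ) :
    slashDerivCoeff k (m + 1) 0 = slashDerivCoeff k m 0 * (k + m) := by
  simp [slashDerivCoeff, Nat.ascFactorial_succ, mul_comm]

/-- One more differentiation: the first summand comes from the power of `c t + d`, the second from
the chain rule applied to `g^(r)(γ t)`. -/
lemma slashDerivCoeff_succ_succ (k m r : ℕ) :
    slashDerivCoeff k (m + 1) (r + 1) =
      slashDerivCoeff k m (r + 1) * (k + m + (r + 1)) + slashDerivCoeff k m r := by
  rcases lt_trichotomy m r with h | rfl | h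
  · rw [slashDerivCoeff_eq_zero (by omega), slashDerivCoeff_eq_zero (by omega),
      slashDerivCoeff_eq_zero h]
    simp
  · rw [slashDerivCoeff_self, slashDerivCoeff_self, slashDerivCoeff_eq_zero (by omega)]
    simp
  · obtain ⟨j, rfl⟩ := Nat.exists_eq_add_of_lt h
    have h1 : (k + r).ascFactorial (j + 1) = (k + r) * (k + r + 1).ascFactorial j :=
      (Nat.succ_ascFactorial (k + r) j ▸ Nat.ascFactorial_succ).trans rfl
    have h2 := Nat.choose_succ_right_eq (r + j + 1) r
    have h3 : r + j + 1 - r = j + 1 := by omega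
    have h4 : r + j + 1 + 1 - (r + 1) = j + 1 := by omega
    have h5 : r + j + 1 - (r + 1) = j := by omega
    rw [h3] at h2
    simp only [slashDerivCoeff, h3, h4, h5, Nat.choose_succ_succ' (r + j + 1) r, h1,
      show k + (r + 1) = k + r + 1 by ring, Nat.ascFactorial_succ]
    zify at h2 ⊢
    linear_combination (-((k + r + 1).ascFactorial j : ℤ)) * h2

/-- The coefficient functions in the formula for the `m`-th derivative of `(ct+d)^(-k) g(γ t)`. -/
noncomputable def slashDerivFactor (c d D : ℂ) (k m r : ℕ) (t : ℂ) : ℂ :=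
  slashDerivCoeff k m r * (-c) ^ (m - r) * D ^ r * (c * t + d)⁻¹ ^ (k + m + r)

lemma slashDerivFactor_eq_zero (c d D : ℂ) (k : ℕ) {m r : ℕ} (h : m < r) (t : ℂ) :
    slashDerivFactor c d D k m r t = 0 := by
  simp [slashDerivFactor, slashDerivCoeff_eq_zero h]

lemma slashDerivFactor_zero_zero (c d D : ℂ) (k : ℕ) (t : ℂ) :
    slashDerivFactor c d D k 0 0 t = (c * t + d)⁻¹ ^ k := by
  simp [slashDerivFactor, slashDerivCoeff]

lemma hasDerivAt_slashDerivFactor (c d D : ℂ) (k m r : ℕ) {t : ℂ} (ht : c * t + d ≠ 0) :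
    HasDerivAt (slashDerivFactor c d D k m r)
      (slashDerivCoeff k m r * (k + m + r) * (-c) ^ (m - r) * (-c) * D ^ r *
        (c * t + d)⁻¹ ^ (k + m + r + 1)) t := by
  have h1 : HasDerivAt (fun t : ℂ => c * t + d) c t := by
    simpa using ((hasDerivAt_id t).const_mul c).add_const d
  have h2 := ((h1.inv ht).pow (k + m + r)).const_mul
    ((slashDerivCoeff k m r : ℂ) * (-c) ^ (m - r) * D ^ r)
  refine h2.congr_deriv ?_
  -- The power rule carries the truncated exponent `k + m + r - 1`, so exponent zero is treated
  -- apart.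
  rcases Nat.eq_zero_or_pos (k + m + r) with h0 | h0
  · have : (k : ℂ) + m + r = 0 := by exact_mod_cast h0
    simp [h0, this]
  · obtain ⟨p, hp⟩ : ∃ p, k + m + r = p + 1 := ⟨k + m + r - 1, by omega⟩
    have : (k : ℂ) + m + r = p + 1 := by exact_mod_cast hp
    rw [hp, this]
    simp only [Nat.add_sub_cancel, Pi.inv_apply, div_eq_mul_inv, ← inv_pow]
    push_cast
    ring

/-- The recursion behind the formula for the derivatives of slashed functions. -/
lemma slashDerivFactor_succ (c d D : ℂ) (k m r : ℕ) {t : ℂ} (ht : c * t + d ≠ 0) :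
    slashDerivFactor c d D k (m + 1) r t = deriv (slashDerivFactor c d D k m r) t +
      if r = 0 then 0 else slashDerivFactor c d D k m (r - 1) t * (D * (c * t + d)⁻¹ ^ 2) := by
  rw [(hasDerivAt_slashDerivFactor c d D k m r ht).deriv]
  cases r with
  | zero =>
    simp only [slashDerivFactor, slashDerivCoeff_succ_zero, if_pos]
    push_cast
    simp only [Nat.sub_zero]
    ring
  | succ r =>
    simp only [slashDerivFactor, slashDerivCoeff_succ_succ, Nat.succ_ne_zero, if_false,
      Nat.add_sub_cancel, Nat.add_sub_add_right]
    rcases lt_or_ge m (r + 1) with h | h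
    · rw [slashDerivCoeff_eq_zero h]
      push_cast
      ring
    · obtain ⟨j, rfl⟩ := Nat.exists_eq_add_of_le h
      simp only [show r + 1 + j - r = j + 1 by omega, show r + 1 + j - (r + 1) = j by omega]
      push_cast
      ring

section SlashDeriv

variable {ι : Type*} [Fintype ι]

-- Reindexing by `r ↦ r + e_i`: the hypothesis disposes of the top layer, the `if` of the bottom
-- one. It collects the chain-rule terms under the order of the derivative they produce.
open scoped Classical in
lemma sum_Icc_shift {M : Type*} [AddCommMonoid M] (N : ι → ℕ) (i : ι) (u : (ι → ℕ) → M)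
    (hu : ∀ r, N i ≤ r i → u r = 0) :
    ∑ r ∈ Finset.Icc 0 N, u r =
      ∑ r ∈ Finset.Icc 0 N, if r i = 0 then 0 else u (r - Pi.single i 1) := by
  have e1 : ∑ r ∈ Finset.Icc 0 N, u r = ∑ r ∈ Finset.Icc 0 N with r i < N i, u r := by
    rw [Finset.sum_filter]
    refine Finset.sum_congr rfl fun r _ => ?_
    split_ifs with h
    · rfl
    · exact hu r (not_lt.1 h)
  have e2 : ∑ r ∈ Finset.Icc 0 N, (if r i = 0 then 0 else u (r - Pi.single i 1)) =
      ∑ r ∈ Finset.Icc 0 N with r i ≠ 0, u (r - Pi.single i 1) := by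
    rw [Finset.sum_filter]
    refine Finset.sum_congr rfl fun r _ => ?_
    by_cases h : r i = 0 <;> simp [h]
  rw [e1, e2]
  refine Finset.sum_nbij' (fun r => r + Pi.single i 1) (fun r => r - Pi.single i 1) ?_ ?_ ?_ ?_ ?_
  · intro r hr
    simp only [Finset.mem_filter, Finset.mem_Icc, Pi.add_apply, Pi.single_eq_same] at hr ⊢
    refine ⟨⟨fun j => Nat.zero_le _, fun j => ?_⟩, by omega⟩
    rcases eq_or_ne j i with rfl | h
    · simp; omega
    · simpa [h] using hr.1.2 j
  · intro r hr
    simp only [Finset.mem_filter, Finset.mem_Icc, Pi.sub_apply, Pi.single_eq_same] at hr ⊢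
    have : r i ≤ N i := hr.1.2 i
    exact ⟨⟨fun j => Nat.zero_le _, fun j => (Nat.sub_le _ _).trans (hr.1.2 j)⟩, by omega⟩
  · intro r _
    simp
  · intro r hr
    simp only [Finset.mem_filter] at hr
    ext j
    rcases eq_or_ne j i with rfl | h
    · simp; omega
    · simp [h]
  · intro r _
    simp

variable {U : Set (ι → ℂ)} {α β c d : ι → ℂ} {k : ι → ℕ}

/-- The componentwise Möbius transformation with the given complex coefficients. -/
noncomputable def moebiusMap (α β c d : ι → ℂ) (z : ι → ℂ) : ι → ℂ :=
  fun i => (α i * z i + β i) / (c i * z i + d i)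

open scoped Classical in
/-- Differentiation of a sum of the shape that occurs in the formula for the derivatives of slashed
functions. -/
lemma partialDeriv_sum_slashDerivFactor (hU : IsOpen U) (hJ : ∀ z ∈ U, ∀ i, c i * z i + d i ≠ 0)
    (hmaps : ∀ z ∈ U, moebiusMap α β c d z ∈ U) {N p : ι → ℕ} {i : ι} (hp : p i < N i)
    {E : (ι → ℕ) → (ι → ℂ) → ℂ} (hE : ∀ r, DifferentiableOn ℂ (E r) U)
    (hEi : ∀ r, Set.EqOn (partialDeriv i (E r)) (E (r + Pi.single i 1)) U) {G : (ι → ℂ) → ℂ}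
    (hG : ∀ z ∈ U, G z = ∑ r ∈ Finset.Icc 0 N,
      (∏ j, slashDerivFactor (c j) (d j) (α j * d j - β j * c j) (k j) (p j) (r j) (z j)) *
        E r (moebiusMap α β c d z)) :
    ∀ z ∈ U, partialDeriv i G z = ∑ r ∈ Finset.Icc 0 N,
      (∏ j, slashDerivFactor (c j) (d j) (α j * d j - β j * c j) (k j)
        ((p + Pi.single i 1 : ι → ℕ) j) (r j) (z j)) * E r (moebiusMap α β c d z) := by
  intro z hz
  set D : ι → ℂ := fun j => α j * d j - β j * c j with hD
  set w := moebiusMap α β c d with hw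
  -- Only the factor `A` at `i` varies with `z i`; the product `B` of the others is constant.
  set B : (ι → ℕ) → ℂ := fun r => ∏ j ∈ Finset.univ.erase i,
    slashDerivFactor (c j) (d j) (D j) (k j) (p j) (r j) (z j) with hB
  set A : ℕ → ℕ → ℂ → ℂ := fun m r t => slashDerivFactor (c i) (d i) (D i) (k i) m r t with hA
  have hJi := hJ z hz i
  have hupd : ∀ t, w (Function.update z i t) =
      Function.update (w z) i ((α i * t + β i) / (c i * t + d i)) := by
    intro t
    ext j
    rcases eq_or_ne j i with rfl | h
    · simp [hw, moebiusMap]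
    · simp [hw, moebiusMap, h]
  have hcoeff : ∀ (q : ι → ℕ) (r : ι → ℕ) (t : ℂ), (∀ j ≠ i, q j = p j) →
      ∏ j, slashDerivFactor (c j) (d j) (D j) (k j) (q j) (r j) (Function.update z i t j) =
      B r * A (q i) (r i) t := by
    intro q r t hq
    rw [← Finset.mul_prod_erase _ _ (Finset.mem_univ i), mul_comm]
    congr 1
    · refine Finset.prod_congr rfl fun j hj => ?_
      have := Finset.ne_of_mem_erase hj
      rw [Function.update_of_ne this, hq j this]
    · simp [hA]
  have hder : ∀ r, HasDerivAt (fun t => B r * A (p i) (r i) t * E r (w (Function.update z i t)))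
      (B r * deriv (A (p i) (r i)) (z i) * E r (w z) +
        B r * A (p i) (r i) (z i) * (D i * (c i * z i + d i)⁻¹ ^ 2) *
          E (r + Pi.single i 1) (w z)) (z i) := by
    intro r
    have h1 : HasDerivAt (fun t => B r * A (p i) (r i) t) (B r * deriv (A (p i) (r i)) (z i))
        (z i) := by
      refine HasDerivAt.const_mul _ ?_
      exact (hasDerivAt_slashDerivFactor _ _ _ _ _ _ hJi).differentiableAt.hasDerivAt
    have h2 : HasDerivAt (fun t => (α i * t + β i) / (c i * t + d i))
        (D i * (c i * z i + d i)⁻¹ ^ 2) (z i) := by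
      have hn : HasDerivAt (fun t : ℂ => α i * t + β i) (α i) (z i) := by
        simpa using ((hasDerivAt_id (z i)).const_mul (α i)).add_const (β i)
      have hd : HasDerivAt (fun t : ℂ => c i * t + d i) (c i) (z i) := by
        simpa using ((hasDerivAt_id (z i)).const_mul (c i)).add_const (d i)
      refine (hn.fun_div hd hJi).congr_deriv ?_
      simp only [hD]
      field_simp
      ring
    have h3 : HasDerivAt (fun s => E r (Function.update (w z) i s)) (E (r + Pi.single i 1) (w z))
        ((α i * z i + β i) / (c i * z i + d i)) := by
      rw [← hEi r (hmaps z hz)]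
      have hdiff : DifferentiableAt ℂ (fun s => E r (Function.update (w z) i s)) (w z i) := by
        have h4 : DifferentiableAt ℂ (E r) (Function.update (w z) i (w z i)) := by
          rw [Function.update_eq_self]
          exact (hE r).differentiableAt (hU.mem_nhds (hmaps z hz))
        exact h4.comp (w z i) (hasDerivAt_update (w z) i (w z i)).differentiableAt
      exact hdiff.hasDerivAt
    have h5 := h3.comp (z i) h2
    refine (h1.mul (h5.congr_of_eventuallyEq (f₁ := fun t => E r (w (Function.update z i t)))
      (Filter.Eventually.of_forall fun t => ?_))).congr_deriv ?_
    · simp [hupd]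
    · simp only [hupd]
      have : (α i * z i + β i) / (c i * z i + d i) = w z i := rfl
      rw [this, Function.update_eq_self]
      ring
  have hsum := HasDerivAt.fun_sum fun r (_ : r ∈ Finset.Icc 0 N) => hder r
  have hpd : partialDeriv i G z = ∑ r ∈ Finset.Icc 0 N,
      (B r * deriv (A (p i) (r i)) (z i) * E r (w z) +
        B r * A (p i) (r i) (z i) * (D i * (c i * z i + d i)⁻¹ ^ 2) *
          E (r + Pi.single i 1) (w z)) := by
    unfold partialDeriv
    refine (Filter.EventuallyEq.deriv_eq ?_).trans hsum.deriv
    have hc : Continuous fun t : ℂ => Function.update z i t :=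
      continuous_const.update i continuous_id
    have : (fun t : ℂ => Function.update z i t) ⁻¹' U ∈ nhds (z i) :=
      hc.continuousAt.preimage_mem_nhds (hU.mem_nhds (by simpa using hz))
    filter_upwards [this] with t ht
    rw [hG _ ht]
    refine Finset.sum_congr rfl fun r _ => ?_
    rw [hcoeff p r t fun _ _ => rfl]
  rw [hpd, Finset.sum_add_distrib]
  -- After the shift, both contributions to a given derivative of the inner function stand at the
  -- same `r` and combine by `slashDerivFactor_succ`. Nothing is lost at the top, because `p i < N
  -- i` makes the factors with `N i ≤ r i` vanish.
  refine (congrArg₂ (· + ·) rfl (sum_Icc_shift N i (fun r => B r * A (p i) (r i) (z i) *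
    (D i * (c i * z i + d i)⁻¹ ^ 2) * E (r + Pi.single i 1) (w z)) ?_)).trans ?_
  rotate_left
  · rw [← Finset.sum_add_distrib]
    refine Finset.sum_congr rfl fun r _ => ?_
    have h1 := hcoeff (p + Pi.single i 1) r (z i) (by intro j hj; simp [hj])
    rw [Function.update_eq_self] at h1
    rw [h1]
    have h2 : A ((p + Pi.single i 1 : ι → ℕ) i) (r i) (z i) = deriv (A (p i) (r i)) (z i) +
        if r i = 0 then 0 else A (p i) (r i - 1) (z i) * (D i * (c i * z i + d i)⁻¹ ^ 2) := by
      simp only [Pi.add_apply, Pi.single_eq_same]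
      exact slashDerivFactor_succ (c i) (d i) (D i) (k i) (p i) (r i) hJi
    rw [h2]
    by_cases hr : r i = 0
    · simp only [hr, if_true]
      ring
    · have e1 : r - Pi.single i 1 + Pi.single i 1 = r := by
        ext j
        rcases eq_or_ne j i with rfl | h
        · simp; omega
        · simp [h]
      have e2 : B (r - Pi.single i 1) = B r := by
        refine Finset.prod_congr rfl fun j hj => ?_
        simp [Finset.ne_of_mem_erase hj]
      simp only [hr, if_false, e1, e2, Pi.sub_apply, Pi.single_eq_same, hA]
      ring
  · intro r hr
    simp only [hA, slashDerivFactor_eq_zero _ _ _ _ (hp.trans_le hr)]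
    ring

lemma listDeriv_congr_index {L : List ι} {i : ι} (hi : i ∉ L) {r r' : ι → ℕ}
    (h : ∀ j ≠ i, r j = r' j) (g : (ι → ℂ) → ℂ) : listDeriv L r g = listDeriv L r' g := by
  induction L with
  | nil => rfl
  | cons j L ihL =>
    have h1 := ihL fun h => hi (List.mem_cons_of_mem _ h)
    have hj : j ≠ i := fun h => hi (h ▸ List.mem_cons_self)
    simp only [listDeriv, List.foldr_cons] at h1 ⊢
    rw [h1, h j hj]

lemma listDeriv_cons (i : ι) (L : List ι) (r : ι → ℕ) (g : (ι → ℂ) → ℂ) :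
    listDeriv (i :: L) r g = (partialDeriv i)^[r i] (listDeriv L r g) := rfl

open scoped Classical in
/-- The formula for the mixed derivatives of slashed functions. -/
lemma listDeriv_slash (hU : IsOpen U) (hJ : ∀ z ∈ U, ∀ i, c i * z i + d i ≠ 0)
    (hmaps : ∀ z ∈ U, moebiusMap α β c d z ∈ U) {g : (ι → ℂ) → ℂ} (hg : DifferentiableOn ℂ g U)
    {N m : ι → ℕ} (hm : m ≤ N) (L : List ι) (hL : L.Nodup) :
    ∀ z ∈ U, listDeriv L m
        (fun z => (∏ j, (c j * z j + d j)⁻¹ ^ k j) * g (moebiusMap α β c d z)) z =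
      ∑ r ∈ Finset.Icc 0 N,
        (∏ j, slashDerivFactor (c j) (d j) (α j * d j - β j * c j) (k j)
          (if j ∈ L then m j else 0) (r j) (z j)) * listDeriv L r g (moebiusMap α β c d z) := by
  induction L with
  | nil =>
    intro z _
    rw [Finset.sum_eq_single 0]
    · simp [listDeriv, slashDerivFactor_zero_zero]
    · intro r _ hr
      obtain ⟨j, hj⟩ := Function.ne_iff.1 hr
      rw [Finset.prod_eq_zero (Finset.mem_univ j), zero_mul]
      exact slashDerivFactor_eq_zero _ _ _ _ (by simpa using Nat.pos_of_ne_zero hj) _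
    · intro h
      exact absurd (Finset.mem_Icc.2 ⟨le_rfl, fun j => Nat.zero_le _⟩) h
  | cons i L ih =>
    obtain ⟨hi, hL'⟩ := List.nodup_cons.1 hL
    have ih := ih hL'
    set G := listDeriv L m (fun z => (∏ j, (c j * z j + d j)⁻¹ ^ k j) * g (moebiusMap α β c d z))
    -- Inner induction on the number `a` of derivatives taken in the new variable `i`.
    have key : ∀ a ≤ m i, ∀ z ∈ U, (partialDeriv i)^[a] G z = ∑ r ∈ Finset.Icc 0 N,
        (∏ j, slashDerivFactor (c j) (d j) (α j * d j - β j * c j) (k j)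
          (((fun j => if j ∈ L then m j else 0) + Pi.single i a : ι → ℕ) j) (r j) (z j)) *
          listDeriv (i :: L) r g (moebiusMap α β c d z) := by
      intro a
      induction a with
      | zero =>
        intro _ z hz
        refine (ih z hz).trans (Finset.sum_congr rfl fun r _ => ?_)
        simp only [Pi.single_zero, add_zero]
        by_cases hr : r i = 0
        · congr 1
          rw [listDeriv_cons, hr, Function.iterate_zero, id]
        -- For `r i ≠ 0` the derivatives along `L` and `i :: L` differ, but no derivative in `i` has
        -- been taken yet, so the coefficient is zero.
        · have : ∏ j, slashDerivFactor (c j) (d j) (α j * d j - β j * c j) (k j)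
              (if j ∈ L then m j else 0) (r j) (z j) = 0 := by
            refine Finset.prod_eq_zero (Finset.mem_univ i) ?_
            exact slashDerivFactor_eq_zero _ _ _ _
              (by simpa [hi] using Nat.pos_of_ne_zero hr) _
          rw [this, zero_mul, zero_mul]
      | succ a iha =>
        intro ha
        have hp : ((fun j => if j ∈ L then m j else 0) + Pi.single i a : ι → ℕ) i < N i := by
          have : m i ≤ N i := hm i
          simp only [Pi.add_apply, hi, if_false, Pi.single_eq_same]
          omega
        have hEi : ∀ r, Set.EqOn (partialDeriv i (listDeriv (i :: L) r g))
            (listDeriv (i :: L) (r + Pi.single i 1) g) U := by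
          intro r z _
          rw [listDeriv_cons, listDeriv_cons, listDeriv_congr_index (r := r + Pi.single i 1)
            (r' := r) hi fun j hj => by simp [hj], Pi.add_apply, Pi.single_eq_same,
            Function.iterate_succ_apply']
        have := partialDeriv_sum_slashDerivFactor hU hJ hmaps hp
          (fun r => hg.listDeriv hU (i :: L) r) hEi (iha (by omega))
        simp only [Function.iterate_succ_apply']
        rw [add_assoc, ← Pi.single_add] at this
        exact this
    intro z hz
    refine (key (m i) le_rfl z hz).trans (Finset.sum_congr rfl fun r _ => ?_)
    congr 1
    refine Finset.prod_congr rfl fun j _ => ?_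
    congr 1
    rcases eq_or_ne j i with rfl | h
    · simp [hi]
    · simp [h]

lemma partialDeriv_const_mul (C : ℂ) (f : (ι → ℂ) → ℂ) (i : ι) :
    partialDeriv i (fun z => C * f z) = fun z => C * partialDeriv i f z := by
  ext z
  exact deriv_const_mul_field C

lemma multiDeriv_const_mul (m : ι → ℕ) (C : ℂ) (f : (ι → ℂ) → ℂ) :
    multiDeriv m (fun z => C * f z) = fun z => C * multiDeriv m f z := by
  have h1 : ∀ (i : ι) (a : ℕ) (f : (ι → ℂ) → ℂ), (partialDeriv i)^[a] (fun z => C * f z) =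
      fun z => C * (partialDeriv i)^[a] f z := by
    intro i a f
    induction a with
    | zero => rfl
    | succ a ih => rw [Function.iterate_succ_apply', ih, partialDeriv_const_mul,
        Function.iterate_succ_apply']
  unfold multiDeriv
  induction (Finset.univ : Finset ι).toList with
  | nil => rfl
  | cons i L ih => simp only [List.foldr_cons] at ih ⊢; rw [ih, h1]

end SlashDeriv

/-! ### Equivariance of the Rankin-Cohen brackets -/

-- The binomial weight of the bracket extends the rising factorial from `k + r, …, k + m - 1` up to
-- `k + n - 1`. Apart from factorials the result no longer depends on `m`, which is why an
-- alternating binomial sum remains.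
open Nat in
lemma choose_mul_slashDerivCoeff {k n m r : ℕ} (hr : r ≤ m) (hm : m ≤ n) :
    (k + n - 1).choose (n - m) * slashDerivCoeff k m r * ((n - m)! * r ! * (m - r)!) =
      (k + r).ascFactorial (n - r) * m ! := by
  have h1 : (n - m)! * (k + n - 1).choose (n - m) = (k + m).ascFactorial (n - m) := by
    rw [Nat.ascFactorial_eq_factorial_mul_choose']
    congr 2
    omega
  have h2 := Nat.choose_mul_factorial_mul_factorial hr
  have h3 := Nat.ascFactorial_mul_ascFactorial (k + r) (m - r) (n - m)
  rw [show k + r + (m - r) = k + m by omega, show m - r + (n - m) = n - r by omega] at h3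
  rw [← h3, ← h2, ← h1, slashDerivCoeff]
  ring

/-- The coefficients of `g^(r) h^(s)` in the bracket of two slashed functions, in one variable. -/
lemma sum_slashDerivFactor_mul (c d D t : ℂ) (k l : ℕ) {n r s : ℕ} (hr : r ≤ n) :
    ∑ m ∈ Finset.Icc 0 n, (-1 : ℂ) ^ m * ((k + n - 1).choose (n - m) : ℂ) *
        ((l + n - 1).choose m : ℂ) * slashDerivFactor c d D k m r t *
        slashDerivFactor c d D l (n - m) s t =
      if s = n - r then (-1 : ℂ) ^ r * ((k + n - 1).choose (n - r) : ℂ) *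
        ((l + n - 1).choose r : ℂ) * D ^ n * (c * t + d)⁻¹ ^ (k + l + 2 * n) else 0 := by
  -- Only `r ≤ m ≤ n - s` can contribute, since a derivative of order `m` produces no derivative of
  -- higher order.
  have hzero : ∀ m ≤ n, ¬ (r ≤ m ∧ m + s ≤ n) → (-1 : ℂ) ^ m * ((k + n - 1).choose (n - m) : ℂ) *
        ((l + n - 1).choose m : ℂ) * slashDerivFactor c d D k m r t *
        slashDerivFactor c d D l (n - m) s t = 0 := by
    intro m hmn hm
    rcases lt_or_ge m r with h | h
    · simp [slashDerivFactor_eq_zero c d D k h]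
    · simp [slashDerivFactor_eq_zero c d D l (show n - m < s by omega)]
  split_ifs with hs
  · subst hs
    rw [Finset.sum_eq_single r]
    · simp only [slashDerivFactor, slashDerivCoeff_self, Nat.sub_self, pow_zero, Nat.cast_one]
      have h1 : (D : ℂ) ^ n = D ^ r * D ^ (n - r) := by rw [← pow_add]; congr 1; omega
      have h2 : k + l + 2 * n = (k + r + r) + (l + (n - r) + (n - r)) := by omega
      rw [h1, h2, pow_add]
      ring
    · intro m hmn hm
      exact hzero m (Finset.mem_Icc.1 hmn).2 (by omega)
    · intro h
      exact absurd (Finset.mem_Icc.2 ⟨Nat.zero_le _, hr⟩) h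
  · rcases lt_or_ge n (r + s) with h | h
    · exact Finset.sum_eq_zero fun m hm => hzero m (Finset.mem_Icc.1 hm).2 (by omega)
    -- `N = n - r - s` counts the derivatives that fall on the automorphy factors. With `m = r + j`,
    -- the `j`-th term is `(-1)^j (N choose j)` times a quantity independent of `j`, and the sum is
    -- `(1 - 1)^N` with `N ≠ 0`.
    obtain ⟨N, rfl⟩ := Nat.exists_eq_add_of_le h
    have hN : N ≠ 0 := by omega
    have key : ∀ j ∈ Finset.range (N + 1),
        (-1 : ℂ) ^ (r + j) * ((k + (r + s + N) - 1).choose (r + s + N - (r + j)) : ℂ) *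
          ((l + (r + s + N) - 1).choose (r + j) : ℂ) * slashDerivFactor c d D k (r + j) r t *
          slashDerivFactor c d D l (r + s + N - (r + j)) s t =
        ((-1 : ℂ) ^ j * (N.choose j : ℂ)) * ((-1 : ℂ) ^ r *
          ((k + r).ascFactorial (s + N) * (l + s).ascFactorial (r + N) /
            (r.factorial * s.factorial * N.factorial)) * (-c) ^ N * D ^ (r + s) *
              (c * t + d)⁻¹ ^ (k + l + (r + s + N) + r + s)) := by
      intro j hj
      obtain ⟨i, rfl⟩ := Nat.exists_eq_add_of_le (Finset.mem_range_succ_iff.1 hj)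
      have e1 : r + s + (j + i) - (r + j) = s + i := by omega
      have c1 := choose_mul_slashDerivCoeff (k := k) (n := r + s + (j + i)) (m := r + j) (r := r)
        (by omega) (by omega)
      have c2 := choose_mul_slashDerivCoeff (k := l) (n := r + s + (j + i)) (m := s + i) (r := s)
        (by omega) (by omega)
      have c3 := Nat.choose_mul_factorial_mul_factorial (Nat.le_add_right j i)
      rw [e1, show r + j - r = j by omega, show r + s + (j + i) - r = s + (j + i) by omega] at c1
      rw [show r + s + (j + i) - (s + i) = r + j by omega, show s + i - s = i by omega,
        show r + s + (j + i) - s = r + (j + i) by omega] at c2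
      rw [show j + i - j = i by omega] at c3
      have f : ∀ x : ℕ, (x.factorial : ℂ) ≠ 0 := fun x => by exact_mod_cast x.factorial_ne_zero
      have c4 : ((k + (r + s + (j + i)) - 1).choose (s + i) : ℂ) * slashDerivCoeff k (r + j) r *
          (((l + (r + s + (j + i)) - 1).choose (r + j) : ℂ) * slashDerivCoeff l (s + i) s) =
          (j + i).choose j * (((k + r).ascFactorial (s + (j + i)) : ℂ) *
            (l + s).ascFactorial (r + (j + i)) /
              (r.factorial * s.factorial * (j + i).factorial)) := by
        have c1' := congrArg (Nat.cast : ℕ → ℂ) c1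
        have c2' := congrArg (Nat.cast : ℕ → ℂ) c2
        have c3' := congrArg (Nat.cast : ℕ → ℂ) c3
        push_cast at c1' c2' c3'
        rw [← c3']
        have hc : ((j + i).choose j : ℂ) ≠ 0 := by
          exact_mod_cast (Nat.choose_pos (Nat.le_add_right j i)).ne'
        have := f r; have := f s; have := f j; have := f i
        have f1 := f (r + j); have f2 := f (s + i)
        field_simp
        -- `(r + j)!` and `(s + i)!` occur crosswise on the two sides of `c1'` and `c2'`, so they
        -- are multiplied in before these are combined.
        refine mul_right_cancel₀ (mul_ne_zero f1 f2) ?_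
        linear_combination ((l + (r + s + (j + i)) - 1).choose (r + j) : ℂ) *
          slashDerivCoeff l (s + i) s * (r + j).factorial * s.factorial * i.factorial * c1' +
          (k + r).ascFactorial (s + (j + i)) * (r + j).factorial * c2'
      simp only [slashDerivFactor, e1, show r + j - r = j by omega, show s + i - s = i by omega]
      rw [show k + l + (r + s + (j + i)) + r + s = (k + (r + j) + r) + (l + (s + i) + s) by omega,
        pow_add ((c * t + d)⁻¹), pow_add (-c) j i, pow_add D r s, pow_add (-1 : ℂ) r j]
      linear_combination ((-1 : ℂ) ^ r * (-1) ^ j * (-c) ^ j * (-c) ^ i * D ^ r * D ^ s *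
        (c * t + d)⁻¹ ^ (k + (r + j) + r) * (c * t + d)⁻¹ ^ (l + (s + i) + s)) * c4
    have h0 : ∑ j ∈ Finset.range (N + 1), (-1 : ℂ) ^ j * (N.choose j : ℂ) = 0 := by
      have := Int.alternating_sum_range_choose_of_ne hN
      exact_mod_cast congrArg (Int.cast : ℤ → ℂ) this
    have hsub : (Finset.range (N + 1)).image (fun j => r + j) ⊆ Finset.Icc 0 (r + s + N) := by
      intro m hm
      obtain ⟨j, hj, rfl⟩ := Finset.mem_image.1 hm
      have := Finset.mem_range.1 hj
      simp only [Finset.mem_Icc]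
      omega
    rw [← Finset.sum_subset hsub, Finset.sum_image (fun a _ b _ h => by simpa using h),
      Finset.sum_congr rfl key, ← Finset.sum_mul, h0, zero_mul]
    intro m hmn hm
    refine hzero m (Finset.mem_Icc.1 hmn).2 fun hm' => hm ?_
    exact Finset.mem_image.2 ⟨m - r, Finset.mem_range.2 (by omega), by omega⟩

section Bracket

variable {ι : Type*} [Fintype ι]

-- Separation of variables: it reduces equivariance to the one-variable identity for each embedding.
open scoped Classical in
lemma sum_Icc_prod_eq_prod_sum (n : ι → ℕ) (u : ι → ℕ → ℂ) :
    ∑ m ∈ Finset.Icc (0 : ι → ℕ) n, ∏ i, u i (m i) = ∏ i, ∑ m ∈ Finset.Icc 0 (n i), u i m := by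
  rw [Finset.prod_univ_sum]
  rfl

variable {F : Type*} [Field F] [NumberField F]

lemma im_moebius_apply (γ : GL (Fin 2) F) (z : (F →+* ℝ) → ℂ) (σ : F →+* ℝ) :
    (moebius γ z σ).im = σ γ.1.det * (z σ).im /
      ‖(σ (γ.1 1 0) : ℂ) * z σ + (σ (γ.1 1 1) : ℂ)‖ ^ 2 := by
  rw [moebius, Complex.div_im, ← Complex.normSq_eq_norm_sq, Matrix.det_fin_two]
  simp only [Complex.add_im, Complex.mul_im, Complex.ofReal_re, Complex.ofReal_im, Complex.add_re,
    Complex.mul_re, map_sub, map_mul]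
  ring

lemma denom_ne_zero {γ : GL (Fin 2) F} (hγ : TotallyPos γ.1.det) {z : (F →+* ℝ) → ℂ}
    (hz : z ∈ upperHalfSpace (F →+* ℝ)) (σ : F →+* ℝ) :
    (σ (γ.1 1 0) : ℂ) * z σ + (σ (γ.1 1 1) : ℂ) ≠ 0 := by
  intro h
  have h1 := congrArg Complex.im h
  have h2 := congrArg Complex.re h
  simp only [Complex.add_im, Complex.mul_im, Complex.ofReal_re, Complex.ofReal_im, Complex.add_re,
    Complex.mul_re, Complex.zero_im, Complex.zero_re, zero_mul, add_zero, sub_zero] at h1 h2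
  have hc : σ (γ.1 1 0) = 0 := (mul_eq_zero.1 h1).resolve_right (hz σ).ne'
  have hd : σ (γ.1 1 1) = 0 := by simpa [hc] using h2
  have := hγ σ
  rw [Matrix.det_fin_two, map_sub, map_mul, map_mul, hc, hd] at this
  simp at this

lemma moebius_mem {γ : GL (Fin 2) F} (hγ : TotallyPos γ.1.det) {z : (F →+* ℝ) → ℂ}
    (hz : z ∈ upperHalfSpace (F →+* ℝ)) : moebius γ z ∈ upperHalfSpace (F →+* ℝ) := by
  intro σ
  rw [im_moebius_apply]
  have := norm_pos_iff.2 (denom_ne_zero hγ hz σ)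
  exact div_pos (mul_pos (hγ σ) (hz σ)) (by positivity)

lemma slash_eq (k : (F →+* ℝ) → ℕ) (γ : GL (Fin 2) F) (f : ((F →+* ℝ) → ℂ) → ℂ)
    (z : (F →+* ℝ) → ℂ) :
    slash k γ f z = (∏ σ, (((σ γ.1.det) ^ ((k σ : ℝ) / 2) : ℝ) : ℂ)) *
      ((∏ σ, ((σ (γ.1 1 0) : ℂ) * z σ + (σ (γ.1 1 1) : ℂ))⁻¹ ^ k σ) * f (moebius γ z)) := by
  rw [slash, Finset.prod_mul_distrib, mul_assoc]
  simp only [inv_pow]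

open scoped Classical in
/-- The formula for the mixed derivatives of `f |_k γ`. -/
lemma multiDeriv_slash {k n m : (F →+* ℝ) → ℕ} (hm : m ≤ n) {γ : GL (Fin 2) F}
    (hγ : TotallyPos γ.1.det) {f : ((F →+* ℝ) → ℂ) → ℂ}
    (hf : DifferentiableOn ℂ f (upperHalfSpace (F →+* ℝ))) {z : (F →+* ℝ) → ℂ}
    (hz : z ∈ upperHalfSpace (F →+* ℝ)) :
    multiDeriv m (slash k γ f) z = (∏ σ, (((σ γ.1.det) ^ ((k σ : ℝ) / 2) : ℝ) : ℂ)) *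
      ∑ r ∈ Finset.Icc 0 n, (∏ σ, slashDerivFactor (σ (γ.1 1 0)) (σ (γ.1 1 1)) (σ γ.1.det)
        (k σ) (m σ) (r σ) (z σ)) * multiDeriv r f (moebius γ z) := by
  have hmaps : ∀ z ∈ upperHalfSpace (F →+* ℝ),
      moebiusMap (fun σ => ((σ (γ.1 0 0) : ℝ) : ℂ)) (fun σ => ((σ (γ.1 0 1) : ℝ) : ℂ))
        (fun σ => ((σ (γ.1 1 0) : ℝ) : ℂ)) (fun σ => ((σ (γ.1 1 1) : ℝ) : ℂ)) z ∈
        upperHalfSpace (F →+* ℝ) := fun z hz => moebius_mem hγ hz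
  have h1 := listDeriv_slash (k := k) (α := fun σ => ((σ (γ.1 0 0) : ℝ) : ℂ))
    (β := fun σ => ((σ (γ.1 0 1) : ℝ) : ℂ)) (c := fun σ => ((σ (γ.1 1 0) : ℝ) : ℂ))
    (d := fun σ => ((σ (γ.1 1 1) : ℝ) : ℂ)) isOpen_upperHalfSpace
    (fun z hz σ => denom_ne_zero hγ hz σ) hmaps hf hm
    Finset.univ.toList (Finset.nodup_toList _) z hz
  have h2 : slash k γ f = fun z => (∏ σ, (((σ γ.1.det) ^ ((k σ : ℝ) / 2) : ℝ) : ℂ)) *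
      ((∏ σ, ((σ (γ.1 1 0) : ℂ) * z σ + (σ (γ.1 1 1) : ℂ))⁻¹ ^ k σ) * f (moebius γ z)) :=
    funext fun z => slash_eq k γ f z
  rw [h2, multiDeriv_const_mul]
  simp only [multiDeriv_eq_listDeriv]
  congr 1
  refine h1.trans (Finset.sum_congr rfl fun r _ => ?_)
  congr 1
  refine Finset.prod_congr rfl fun σ _ => ?_
  simp [Matrix.det_fin_two]

lemma multiDeriv_congr_rankinCohen {k l n : ι → ℕ} {U : Set (ι → ℂ)} (hU : IsOpen U)
    {f f' g : (ι → ℂ) → ℂ} (h : Set.EqOn f f' U) {z : ι → ℂ} (hz : z ∈ U) :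
    rankinCohen k l n f g z = rankinCohen k l n f' g z := by
  unfold rankinCohen
  exact Finset.sum_congr rfl fun m _ => by rw [multiDeriv_congr hU h m hz]

open scoped Classical in
/-- Cohen's theorem: the Rankin-Cohen bracket is equivariant. -/
theorem rankinCohen_slash (k l n : (F →+* ℝ) → ℕ) {γ : GL (Fin 2) F}
    (hγ : TotallyPos γ.1.det) {f g : ((F →+* ℝ) → ℂ) → ℂ}
    (hf : DifferentiableOn ℂ f (upperHalfSpace (F →+* ℝ)))
    (hg : DifferentiableOn ℂ g (upperHalfSpace (F →+* ℝ))) {z : (F →+* ℝ) → ℂ}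
    (hz : z ∈ upperHalfSpace (F →+* ℝ)) :
    rankinCohen k l n (slash k γ f) (slash l γ g) z =
      slash (k + l + 2 * n) γ (rankinCohen k l n f g) z := by
  set A : (k : (F →+* ℝ) → ℕ) → ((F →+* ℝ) → ℕ) → ((F →+* ℝ) → ℕ) → ℂ := fun k m r =>
    ∏ σ, slashDerivFactor (σ (γ.1 1 0)) (σ (γ.1 1 1)) (σ γ.1.det) (k σ) (m σ) (r σ) (z σ) with hA
  set K : ((F →+* ℝ) → ℕ) → ℂ := fun k => ∏ σ, (((σ γ.1.det) ^ ((k σ : ℝ) / 2) : ℝ) : ℂ) with hK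
  set w : ((F →+* ℝ) → ℕ) → ((F →+* ℝ) → ℕ) → ((F →+* ℝ) → ℕ) → ℂ := fun m p q =>
    (-1 : ℂ) ^ (∑ i, m i) * (multiChoose (k + n - 1) p : ℂ) * (multiChoose (l + n - 1) q : ℂ)
    with hw
  have hterm : ∀ r ∈ Finset.Icc 0 n, ∀ s, ∑ m ∈ Finset.Icc 0 n,
      w m (n - m) m * A k m r * A l (n - m) s =
      if s = n - r then w r (n - r) r * ∏ σ, (σ γ.1.det : ℂ) ^ n σ *
        ((σ (γ.1 1 0) : ℂ) * z σ + (σ (γ.1 1 1) : ℂ))⁻¹ ^ (k σ + l σ + 2 * n σ) else 0 := by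
    intro r hr s
    have hr' : ∀ σ, r σ ≤ n σ := (Finset.mem_Icc.1 hr).2
    have e1 : ∀ m p q, w m p q = ∏ σ, (-1 : ℂ) ^ m σ * ((k σ + n σ - 1).choose (p σ) : ℂ) *
        ((l σ + n σ - 1).choose (q σ) : ℂ) := by
      intro m p q
      simp only [hw, multiChoose, Finset.prod_mul_distrib, Finset.prod_pow_eq_pow_sum]
      push_cast
      rfl
    have e2 := sum_Icc_prod_eq_prod_sum n fun σ m =>
      (-1 : ℂ) ^ m * ((k σ + n σ - 1).choose (n σ - m) : ℂ) *
        ((l σ + n σ - 1).choose m : ℂ) *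
        slashDerivFactor (σ (γ.1 1 0)) (σ (γ.1 1 1)) (σ γ.1.det) (k σ) m (r σ) (z σ) *
        slashDerivFactor (σ (γ.1 1 0)) (σ (γ.1 1 1)) (σ γ.1.det) (l σ) (n σ - m) (s σ) (z σ)
    simp only [sum_slashDerivFactor_mul _ _ _ _ _ _ (hr' _)] at e2
    calc _ = _ := Finset.sum_congr rfl fun m _ => by
          rw [e1, hA, ← Finset.prod_mul_distrib, ← Finset.prod_mul_distrib]
          rfl
      _ = _ := e2
      _ = _ := by
          split_ifs with hs
          · rw [e1, ← Finset.prod_mul_distrib]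
            refine Finset.prod_congr rfl fun σ _ => ?_
            rw [if_pos (by rw [hs]; rfl)]
            simp only [Pi.sub_apply]
            ring
          · obtain ⟨σ, hσ⟩ := Function.ne_iff.1 hs
            exact Finset.prod_eq_zero (Finset.mem_univ σ) (if_neg hσ)
  -- The excess weight `2 n` demands `det^n`, which is exactly the power `D ^ n` produced by
  -- `sum_slashDerivFactor_mul`.
  have hKK : K (k + l + 2 * n) = K k * K l * ∏ σ, (σ γ.1.det : ℂ) ^ n σ := by
    simp only [hK, ← Finset.prod_mul_distrib]
    refine Finset.prod_congr rfl fun σ _ => ?_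
    have h1 : (((k + l + 2 * n) σ : ℕ) : ℝ) / 2 = k σ / 2 + l σ / 2 + n σ := by
      simp only [Pi.add_apply, Pi.mul_apply, Pi.ofNat_apply]
      push_cast
      ring
    rw [h1, Real.rpow_add (hγ σ), Real.rpow_add (hγ σ), Real.rpow_natCast]
    push_cast
    rfl
  rw [slash_eq]
  change _ = K (k + l + 2 * n) * _
  have hLHS : rankinCohen k l n (slash k γ f) (slash l γ g) z =
      K k * K l * ∑ r ∈ Finset.Icc 0 n, ∑ s ∈ Finset.Icc 0 n,
        (∑ m ∈ Finset.Icc 0 n, w m (n - m) m * A k m r * A l (n - m) s) *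
          (multiDeriv r f (moebius γ z) * multiDeriv s g (moebius γ z)) := by
    have h1 : rankinCohen k l n (slash k γ f) (slash l γ g) z =
        ∑ m ∈ Finset.Icc 0 n, ∑ r ∈ Finset.Icc 0 n, ∑ s ∈ Finset.Icc 0 n,
          K k * K l * (w m (n - m) m * A k m r * A l (n - m) s *
            (multiDeriv r f (moebius γ z) * multiDeriv s g (moebius γ z))) := by
      unfold rankinCohen
      refine Finset.sum_congr rfl fun m hm => ?_
      -- Both expansions run over the full range up to `n`, independent of `m`, so that the sum over
      -- `m` can be moved inside.
      rw [multiDeriv_slash (Finset.mem_Icc.1 hm).2 hγ hf hz,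
        multiDeriv_slash (n := n) (m := n - m) (fun σ => Nat.sub_le _ _) hγ hg hz]
      calc _ = (w m (n - m) m * (K k * K l)) *
            ((∑ r ∈ Finset.Icc 0 n, A k m r * multiDeriv r f (moebius γ z)) *
            ∑ s ∈ Finset.Icc 0 n, A l (n - m) s * multiDeriv s g (moebius γ z)) := by
              simp only [hw, hK, hA]; ring
        _ = _ := by
          rw [Finset.sum_mul_sum, Finset.mul_sum]
          refine Finset.sum_congr rfl fun r _ => ?_
          rw [Finset.mul_sum]
          refine Finset.sum_congr rfl fun s _ => ?_
          ring
    rw [h1, Finset.sum_comm, Finset.mul_sum]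
    refine Finset.sum_congr rfl fun r _ => ?_
    rw [Finset.sum_comm, Finset.mul_sum]
    refine Finset.sum_congr rfl fun s _ => ?_
    rw [Finset.sum_mul, Finset.mul_sum]
  rw [hLHS, hKK, Finset.prod_congr rfl fun σ _ => rfl]
  have hsum : ∀ r ∈ Finset.Icc 0 n, ∑ s ∈ Finset.Icc 0 n,
        (∑ m ∈ Finset.Icc 0 n, w m (n - m) m * A k m r * A l (n - m) s) *
          (multiDeriv r f (moebius γ z) * multiDeriv s g (moebius γ z)) =
      (∏ σ, (σ γ.1.det : ℂ) ^ n σ *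
        ((σ (γ.1 1 0) : ℂ) * z σ + (σ (γ.1 1 1) : ℂ))⁻¹ ^ (k σ + l σ + 2 * n σ)) *
      (w r (n - r) r * multiDeriv r f (moebius γ z) * multiDeriv (n - r) g (moebius γ z)) := by
    intro r hr
    rw [Finset.sum_eq_single (n - r)]
    · rw [hterm r hr, if_pos rfl]
      ring
    · intro s _ hs
      rw [hterm r hr, if_neg hs, zero_mul]
    · intro h
      exact absurd (Finset.mem_Icc.2 ⟨fun σ => Nat.zero_le _, fun σ => Nat.sub_le _ _⟩) h
  rw [Finset.sum_congr rfl hsum, ← Finset.mul_sum, Finset.prod_mul_distrib]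
  unfold rankinCohen
  simp only [Pi.add_apply, Pi.mul_apply, Pi.ofNat_apply, hw]
  ring

end Bracket

/-! ### Totally real fields: norms and units -/

section TotallyReal

variable {F : Type*} [Field F] [NumberField F]

/-- The infinite place of a real embedding. -/
noncomputable def realPlace (σ : F →+* ℝ) : InfinitePlace F :=
  InfinitePlace.mk (Complex.ofRealHom.comp σ)

lemma realPlace_apply (σ : F →+* ℝ) (x : F) : realPlace σ x = |σ x| := by
  simp [realPlace]

variable [NumberField.IsTotallyReal F]

-- A real embedding is its own conjugate, and all places are real. This carries the norm formula and
-- the unit theorem over from places to real embeddings.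
variable (F) in
lemma realPlace_bijective : Function.Bijective (realPlace (F := F)) := by
  constructor
  · intro σ τ h
    have hconj : ComplexEmbedding.conjugate (Complex.ofRealHom.comp σ) =
        Complex.ofRealHom.comp σ := by
      ext x
      simp [ComplexEmbedding.conjugate]
    have h1 : Complex.ofRealHom.comp σ = Complex.ofRealHom.comp τ := by
      rcases InfinitePlace.mk_eq_iff.1 h with h | h
      · exact h
      · rwa [hconj] at h
    ext x
    have := congrArg (fun f : F →+* ℂ => f x) h1
    simpa using this
  · intro w
    have hw : w.IsReal := IsTotallyReal.isReal w
    refine ⟨InfinitePlace.embedding_of_isReal hw, ?_⟩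
    conv_rhs => rw [← InfinitePlace.mk_embedding w]
    unfold realPlace
    congr 1
    ext x
    simp

variable (F) in
lemma card_realEmbeddings : Fintype.card (F →+* ℝ) = Module.finrank ℚ F := by
  rw [Fintype.card_of_bijective (realPlace_bijective F), IsTotallyReal.finrank,
    InfinitePlace.card_eq_nrRealPlaces_add_nrComplexPlaces, IsTotallyReal.nrComplexPlaces_eq_zero,
    add_zero]

variable (F) in
lemma nonempty_realEmbeddings : Nonempty (F →+* ℝ) := by
  rw [← Fintype.card_pos_iff, card_realEmbeddings]
  exact Module.finrank_pos

lemma prod_abs_realEmbeddings (x : F) :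
    ∏ σ : F →+* ℝ, |σ x| = ((|Algebra.norm ℚ x| : ℚ) : ℝ) := by
  rw [← InfinitePlace.prod_eq_abs_norm, ← (realPlace_bijective F).prod_comp]
  exact Finset.prod_congr rfl fun σ _ => by simp [realPlace_apply]

lemma one_le_prod_abs {x : 𝓞 F} (hx : x ≠ 0) : 1 ≤ ∏ σ : F →+* ℝ, |σ (x : F)| := by
  rw [prod_abs_realEmbeddings]
  have h1 : (Algebra.norm ℚ) (x : F) = ((Algebra.norm ℤ x : ℤ) : ℚ) :=
    (Algebra.coe_norm_int x).symm
  rw [h1]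
  have h2 : Algebra.norm ℤ x ≠ 0 := Algebra.norm_ne_zero_iff.2 hx
  exact_mod_cast Int.one_le_abs h2

/-- The norms of the nonzero elements of a fractional ideal are bounded below. -/
lemma exists_le_prod_abs (I : FractionalIdeal (𝓞 F)⁰ F) :
    ∃ c : ℝ, 0 < c ∧ ∀ ν ∈ I, ν ≠ 0 → c ≤ ∏ σ : F →+* ℝ, |σ ν| := by
  obtain ⟨a, ha, h⟩ := I.isFractional
  have ha0 : a ≠ 0 := nonZeroDivisors.ne_zero ha
  have ha' : 1 ≤ ∏ σ : F →+* ℝ, |σ (a : F)| := one_le_prod_abs ha0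
  refine ⟨(∏ σ : F →+* ℝ, |σ (a : F)|)⁻¹, by positivity, fun ν hν hν0 => ?_⟩
  obtain ⟨x, hx⟩ := h ν hν
  rw [Algebra.smul_def] at hx
  have hx0 : x ≠ 0 := by
    rintro rfl
    rw [map_zero, eq_comm, mul_eq_zero] at hx
    exact hx.elim (by simpa using ha0) hν0
  have h1 := one_le_prod_abs hx0
  have h2 : ∏ σ : F →+* ℝ, |σ (x : F)| = (∏ σ : F →+* ℝ, |σ (a : F)|) * ∏ σ : F →+* ℝ, |σ ν| := by
    rw [← Finset.prod_mul_distrib]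
    refine Finset.prod_congr rfl fun σ _ => ?_
    rw [← abs_mul, ← map_mul, ← hx]
  rw [inv_le_iff_one_le_mul₀' (by positivity)]
  rwa [h2] at h1

/-- The number of elements of a fractional ideal whose conjugates are positive and bounded by given
numbers is at most a constant times the product of these numbers. -/
lemma exists_card_le_prod (I : FractionalIdeal (𝓞 F)⁰ F) :
    ∃ C : ℝ, 0 < C ∧ ∀ (X : (F →+* ℝ) → ℝ) (S : Finset F), (∀ σ, 0 < X σ) →
      (∀ ν ∈ S, ν ∈ I ∧ ∀ σ : F →+* ℝ, 0 < σ ν ∧ σ ν ≤ X σ) → (S.card : ℝ) ≤ C * ∏ σ, X σ := by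
  classical
  obtain ⟨c, hc, hI⟩ := exists_le_prod_abs I
  have := nonempty_realEmbeddings F
  set d := Fintype.card (F →+* ℝ) with hd
  have hd0 : d ≠ 0 := Fintype.card_ne_zero
  refine ⟨3 ^ d / c, by positivity, fun X S hX hS => ?_⟩
  rcases S.eq_empty_or_nonempty with rfl | ⟨ν₀, hν₀⟩
  · have : 0 < ∏ σ, X σ := Finset.prod_pos fun σ _ => hX σ
    simp only [Finset.card_empty, Nat.cast_zero]
    positivity
  -- A nonempty box has volume at least `c`, so that `t ≥ 1` below and rounding `t` up costs only a
  -- constant factor.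
  have hcX : c ≤ ∏ σ, X σ := by
    refine (hI ν₀ (hS ν₀ hν₀).1 ?_).trans (Finset.prod_le_prod (fun _ _ => abs_nonneg _) ?_)
    · rintro rfl
      obtain ⟨σ⟩ := this
      simpa using ((hS 0 hν₀).2 σ).1
    · intro σ _
      rw [abs_of_pos ((hS ν₀ hν₀).2 σ).1]
      exact ((hS ν₀ hν₀).2 σ).2
  set t : ℝ := ((∏ σ, X σ) / c) ^ (1 / (d : ℝ)) with ht
  have hq : 1 ≤ (∏ σ, X σ) / c := (one_le_div hc).2 hcX
  have ht1 : 1 ≤ t := Real.one_le_rpow hq (by positivity)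
  have htd : t ^ d = (∏ σ, X σ) / c := by
    rw [ht, ← Real.rpow_natCast, ← Real.rpow_mul (by positivity), one_div,
      inv_mul_cancel₀ (by exact_mod_cast hd0), Real.rpow_one]
  -- Pigeonhole: each side is cut into `m > t` pieces. Two elements in one cell would differ by an
  -- element of norm at most `∏ X / m ^ d < c`, hence are equal. The floors run through `0, …, m`,
  -- which accounts for the `m + 1`.
  set m : ℕ := ⌊t⌋₊ + 1 with hm
  have htm : t < m := by simpa [hm] using Nat.lt_floor_add_one t
  have hmt : (m : ℝ) + 1 ≤ 3 * t := by
    have := Nat.floor_le (zero_le_one.trans ht1)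
    rw [hm]; push_cast; linarith
  have hm0 : (0 : ℝ) < m := by linarith
  have hcard : S.card ≤ (m + 1) ^ d := by
    have h1 : S.card ≤ (Fintype.piFinset fun _ : F →+* ℝ => Finset.range (m + 1)).card := by
      refine Finset.card_le_card_of_injOn (fun ν σ => ⌊m * σ ν / X σ⌋₊) ?_ ?_
      · intro ν hν
        rw [Finset.mem_coe, Fintype.mem_piFinset]
        intro σ
        rw [Finset.mem_range]
        have h2 := (hS ν hν).2 σ
        have h3 : m * σ ν / X σ ≤ m := by
          rw [div_le_iff₀ (hX σ)]
          exact mul_le_mul_of_nonneg_left h2.2 hm0.le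
        have := Nat.floor_le_floor h3
        rw [Nat.floor_natCast] at this
        exact Nat.lt_succ_of_le this
      · intro ν hν μ hμ h
        by_contra hne
        have h4 := hI (ν - μ) (Submodule.sub_mem _ (hS ν hν).1 (hS μ hμ).1) (sub_ne_zero.2 hne)
        have h5 : ∏ σ : F →+* ℝ, |σ (ν - μ)| ≤ ∏ σ, X σ / m := by
          refine Finset.prod_le_prod (fun _ _ => abs_nonneg _) fun σ _ => ?_
          have h6 := congrFun h σ
          have hpν : 0 ≤ m * σ ν / X σ :=
            div_nonneg (mul_nonneg hm0.le ((hS ν hν).2 σ).1.le) (hX σ).le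
          have hpμ : 0 ≤ m * σ μ / X σ :=
            div_nonneg (mul_nonneg hm0.le ((hS μ hμ).2 σ).1.le) (hX σ).le
          have a1 := Nat.floor_le hpν
          have a2 := Nat.lt_floor_add_one (m * σ ν / X σ)
          have a3 := Nat.floor_le hpμ
          have a4 := Nat.lt_floor_add_one (m * σ μ / X σ)
          simp only at h6
          rw [h6] at a1 a2
          have a5 : |m * σ ν / X σ - m * σ μ / X σ| ≤ 1 := by rw [abs_le]; constructor <;> linarith
          have a6 : m * σ ν / X σ - m * σ μ / X σ = σ (ν - μ) * (m / X σ) := by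
            rw [map_sub]; ring
          rw [a6, abs_mul, abs_of_pos (div_pos hm0 (hX σ))] at a5
          rw [le_div_iff₀ hm0]
          rwa [mul_div_assoc', div_le_one (hX σ)] at a5
        rw [Finset.prod_div_distrib, Finset.prod_const, Finset.card_univ, ← hd] at h5
        have h7 : (∏ σ, X σ) / (m : ℝ) ^ d < c := by
          rw [div_lt_iff₀ (by positivity), ← div_lt_iff₀' hc, ← htd]
          exact pow_lt_pow_left₀ htm (by positivity) hd0
        linarith
    simpa [Fintype.card_piFinset] using h1
  calc (S.card : ℝ) ≤ ((m : ℝ) + 1) ^ d := by exact_mod_cast hcard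
    _ ≤ (3 * t) ^ d := pow_le_pow_left₀ (by positivity) hmt d
    _ = 3 ^ d / c * ∏ σ, X σ := by rw [mul_pow, htd]; ring

variable (F) in
/-- Any positive vector can be balanced by a unit. -/
lemma exists_unit_balanced : ∃ B : ℝ, 0 < B ∧ ∀ t : (F →+* ℝ) → ℝ, (∀ σ, 0 < t σ) →
    ∃ η : (𝓞 F)ˣ, ∀ σ τ : F →+* ℝ,
      |σ ((η : 𝓞 F) : F)| * t σ ≤ B * (|τ ((η : 𝓞 F) : F)| * t τ) := by
  classical
  obtain ⟨M, hM0, hM⟩ : ∃ M : ℝ, 0 ≤ M ∧ ∀ x : Units.dirichletUnitTheorem.logSpace F,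
      ∃ η : (𝓞 F)ˣ, ‖x + Units.logEmbedding F (Additive.ofMul η)‖ ≤ M := by
    -- The logarithms of the units form a full lattice; subtracting the integral part with respect
    -- to a basis leaves a bounded remainder.
    set b := (Units.basisUnitLattice F).ofZLatticeBasis ℝ (Units.unitLattice F)
    refine ⟨∑ i, ‖b i‖, by positivity, fun x => ?_⟩
    have h1 : -(ZSpan.floor b x : Units.dirichletUnitTheorem.logSpace F) ∈ Units.unitLattice F := by
      exact Submodule.neg_mem _
        ((Module.Basis.ofZLatticeBasis_span ℝ (Units.unitLattice F) _).le (ZSpan.floor b x).2)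
    obtain ⟨η, -, hη⟩ := h1
    refine ⟨η.toMul, ?_⟩
    have h2 : Units.logEmbedding F (Additive.ofMul η.toMul) =
        -(ZSpan.floor b x : Units.dirichletUnitTheorem.logSpace F) := hη
    rw [h2, ← sub_eq_add_neg]
    exact ZSpan.norm_fract_le b x
  set d : ℕ := Fintype.card (InfinitePlace F)
  have hd : (0 : ℝ) < d := by exact_mod_cast Fintype.card_pos
  -- Any two of the logarithms `v w` below differ by at most `2 d M`.
  refine ⟨Real.exp (2 * (d * M)), Real.exp_pos _, fun t ht => ?_⟩
  set e := Equiv.ofBijective _ (realPlace_bijective F)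
  set y : InfinitePlace F → ℝ := fun w => Real.log (t (e.symm w)) with hy
  -- Subtracting the mean makes the coordinates sum to zero, so the one at `w₀`, which `logSpace`
  -- omits, is controlled by the others.
  set m : ℝ := (∑ w, y w) / d with hm
  obtain ⟨η, hη⟩ := hM fun w => y w - m
  set v : InfinitePlace F → ℝ := fun w => y w - m + Real.log (w ((η : 𝓞 F) : F)) with hv
  have hv1 : ∀ w ≠ Units.dirichletUnitTheorem.w₀, |v w| ≤ M := by
    intro w hw
    have := (norm_le_pi_norm _ (⟨w, hw⟩ : {w : InfinitePlace F //
      w ≠ Units.dirichletUnitTheorem.w₀})).trans hη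
    simpa [hv] using this
  have hvsum : ∑ w, v w = 0 := by
    have h1 := Units.sum_mult_mul_log η
    simp only [IsTotallyReal.mult_eq, Nat.cast_one, one_mul] at h1
    simp only [hv, Finset.sum_add_distrib, Finset.sum_sub_distrib, h1, Finset.sum_const,
      Finset.card_univ, nsmul_eq_mul, add_zero, hm]
    change _ - (d : ℝ) * _ = 0
    field_simp
    ring
  have hv2 : ∀ w, |v w| ≤ d * M := by
    intro w
    by_cases hw : w = Units.dirichletUnitTheorem.w₀
    · have h1 : v w = -∑ w' ∈ Finset.univ.erase w, v w' := by
        rw [← Finset.add_sum_erase _ _ (Finset.mem_univ w)] at hvsum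
        linarith
      rw [h1, abs_neg]
      calc |∑ w' ∈ Finset.univ.erase w, v w'| ≤ ∑ w' ∈ Finset.univ.erase w, |v w'| :=
            Finset.abs_sum_le_sum_abs _ _
        _ ≤ ∑ w' ∈ Finset.univ.erase w, M :=
            Finset.sum_le_sum fun w' hw' => hv1 w' (hw ▸ Finset.ne_of_mem_erase hw')
        _ ≤ ∑ w' : InfinitePlace F, M :=
            Finset.sum_le_sum_of_subset_of_nonneg (Finset.erase_subset _ _) fun _ _ _ => hM0
        _ = d * M := by simp [d]
    · refine (hv1 w hw).trans (le_mul_of_one_le_left hM0 ?_)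
      exact_mod_cast Nat.one_le_iff_ne_zero.2 Fintype.card_ne_zero
  have hη0 : ∀ σ : F →+* ℝ, 0 < |σ ((η : 𝓞 F) : F)| := fun σ => by simp
  have hexp : ∀ σ : F →+* ℝ,
      |σ ((η : 𝓞 F) : F)| * t σ = Real.exp m * Real.exp (v (realPlace σ)) := by
    intro σ
    have h1 : e.symm (realPlace σ) = σ := e.symm_apply_apply σ
    rw [← Real.exp_add]
    simp only [hv, hy, h1, realPlace_apply]
    rw [show m + (Real.log (t σ) - m + Real.log |σ ((η : 𝓞 F) : F)|) =
      Real.log |σ ((η : 𝓞 F) : F)| + Real.log (t σ) by ring, Real.exp_add, Real.exp_log (hη0 σ),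
      Real.exp_log (ht σ)]
  refine ⟨η, fun σ τ => ?_⟩
  rw [hexp, hexp, mul_left_comm]
  refine mul_le_mul_of_nonneg_left ?_ (Real.exp_pos _).le
  rw [← Real.exp_add, Real.exp_le_exp]
  have h1 := (abs_le.1 (hv2 (realPlace σ))).2
  have h2 := (abs_le.1 (hv2 (realPlace τ))).1
  linarith

end TotallyReal

/-! ### Convergence of sums over fractional ideals -/

section LatticeSums

lemma summable_two_rpow_neg_abs {δ : ℝ} (hδ : 0 < δ) :
    Summable fun j : ℤ => (2 : ℝ) ^ (-δ * |(j : ℝ)|) := by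
  have h : Summable fun n : ℕ => (2 : ℝ) ^ (-δ * (n : ℝ)) := by
    have h1 : Summable fun n : ℕ => ((2 : ℝ) ^ (-δ)) ^ n :=
      summable_geometric_of_lt_one (by positivity)
        (Real.rpow_lt_one_of_one_lt_of_neg (by norm_num) (by linarith))
    refine h1.congr fun n => ?_
    rw [← Real.rpow_natCast, ← Real.rpow_mul (by norm_num)]
  refine Summable.of_nat_of_neg ?_ ?_
  · simpa using h
  · simpa using h

/-- A weight for sums over lattices. -/
noncomputable def latticeWeight (δ x : ℝ) : ℝ := min (x ^ δ) (x ^ (-δ)) / x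

/-- This default value lets the weights be summed over `posOrZero`; the constant term of the
q-series is accounted for separately. -/
lemma latticeWeight_zero (δ : ℝ) : latticeWeight δ 0 = 0 := by simp [latticeWeight]

lemma latticeWeight_pos {δ x : ℝ} (hx : 0 < x) : 0 < latticeWeight δ x := by
  unfold latticeWeight
  positivity

/-- On the block `[2^j, 2^(j+1))` the factor `2^(-j)` offsets the growth of the lattice point count,
and `2^(-δ|j|)` makes the sum over `j` converge. The constant `2 ^ δ` is lost only for `j < 0`,
where the upper endpoint is used. -/
lemma latticeWeight_le {δ x : ℝ} (hδ : 0 < δ) (hx : 0 < x) :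
    latticeWeight δ x ≤
      2 ^ δ * 2 ^ (-δ * |((Int.log 2 x : ℤ) : ℝ)|) * ((2 : ℝ) ^ Int.log 2 x)⁻¹ := by
  set j := Int.log 2 x
  have h1 : (2 : ℝ) ^ j ≤ x := by exact_mod_cast Int.zpow_log_le_self (b := 2) (by norm_num) hx
  have h2 : x < (2 : ℝ) ^ (j + 1) := by
    exact_mod_cast Int.lt_zpow_succ_log_self (b := 2) (by norm_num) x
  have hj : (0 : ℝ) < 2 ^ j := by positivity
  rw [latticeWeight, div_eq_mul_inv]
  refine mul_le_mul ?_ (inv_anti₀ hj h1) (by positivity) (by positivity)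
  rw [← Real.rpow_add (by norm_num)]
  rcases le_or_gt 0 j with h | h
  · refine (min_le_right _ _).trans ?_
    calc x ^ (-δ) ≤ ((2 : ℝ) ^ j) ^ (-δ) :=
          Real.rpow_le_rpow_of_nonpos hj h1 (by linarith)
      _ = 2 ^ (-δ * (j : ℝ)) := by
          rw [← Real.rpow_intCast, ← Real.rpow_mul (by norm_num), mul_comm]
      _ ≤ _ := by
          refine Real.rpow_le_rpow_of_exponent_le (by norm_num) ?_
          rw [abs_of_nonneg (by exact_mod_cast h)]
          linarith
  · refine (min_le_left _ _).trans ?_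
    calc x ^ δ ≤ ((2 : ℝ) ^ (j + 1)) ^ δ := Real.rpow_le_rpow hx.le h2.le hδ.le
      _ = 2 ^ (((j : ℝ) + 1) * δ) := by
          rw [← Real.rpow_intCast, ← Real.rpow_mul (by norm_num)]
          push_cast
          rfl
      _ ≤ _ := by
          refine Real.rpow_le_rpow_of_exponent_le (by norm_num) ?_
          rw [abs_of_neg (by exact_mod_cast h)]
          linarith

variable {F : Type*} [Field F] [NumberField F] [NumberField.IsTotallyReal F]

/-- The elements are sorted into dyadic boxes according to the logarithms of their conjugates.
`exists_card_le_prod` bounds the count in each box, and the sum over boxes is dominated by a product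
of geometric sums. -/
lemma exists_sum_latticeWeight_le (I : FractionalIdeal (𝓞 F)⁰ F) {δ : ℝ} (hδ : 0 < δ) :
    ∃ K : ℝ, ∀ S : Finset F, (∀ ν ∈ S, ν ∈ I ∧ TotallyPos ν) →
      ∑ ν ∈ S, ∏ σ : F →+* ℝ, latticeWeight δ (σ ν) ≤ K := by
  classical
  obtain ⟨C, hC, hcard⟩ := exists_card_le_prod I
  set w : ℤ → ℝ := fun j => (2 : ℝ) ^ (-δ * |(j : ℝ)|) with hw
  have hw0 : ∀ j, 0 < w j := fun j => by positivity
  set d := Fintype.card (F →+* ℝ) with hd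
  refine ⟨C * (2 * 2 ^ δ) ^ d * (∑' j, w j) ^ d, fun S hS => ?_⟩
  set J : F → (F →+* ℝ) → ℤ := fun ν σ => Int.log 2 (σ ν) with hJ
  have hfib : ∀ j ∈ S.image J, ∑ ν ∈ S with J ν = j, ∏ σ : F →+* ℝ, latticeWeight δ (σ ν) ≤
      C * (2 * 2 ^ δ) ^ d * ∏ σ, w (j σ) := by
    intro j _
    have h1 : ∀ ν ∈ S.filter (fun ν => J ν = j), ∏ σ : F →+* ℝ, latticeWeight δ (σ ν) ≤
        ∏ σ : F →+* ℝ, 2 ^ δ * w (j σ) * ((2 : ℝ) ^ j σ)⁻¹ := by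
      intro ν hν
      obtain ⟨hνS, hνj⟩ := Finset.mem_filter.1 hν
      refine Finset.prod_le_prod (fun σ _ => (latticeWeight_pos ((hS ν hνS).2 σ)).le) fun σ _ => ?_
      rw [← hνj]
      exact latticeWeight_le hδ ((hS ν hνS).2 σ)
    have h2 := hcard (fun σ => (2 : ℝ) ^ (j σ + 1)) (S.filter fun ν => J ν = j)
      (fun σ => by positivity) (by
        intro ν hν
        obtain ⟨hνS, hνj⟩ := Finset.mem_filter.1 hν
        refine ⟨(hS ν hνS).1, fun σ => ⟨(hS ν hνS).2 σ, ?_⟩⟩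
        rw [← hνj]
        have := Int.lt_zpow_succ_log_self (b := 2) (by norm_num) (σ ν)
        exact_mod_cast this.le)
    calc _ ≤ ((S.filter fun ν => J ν = j).card : ℝ) *
          ∏ σ : F →+* ℝ, 2 ^ δ * w (j σ) * ((2 : ℝ) ^ j σ)⁻¹ := by
            rw [← nsmul_eq_mul]
            exact Finset.sum_le_card_nsmul _ _ _ h1
      _ ≤ (C * ∏ σ, (2 : ℝ) ^ (j σ + 1)) *
          ∏ σ : F →+* ℝ, 2 ^ δ * w (j σ) * ((2 : ℝ) ^ j σ)⁻¹ :=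
            mul_le_mul_of_nonneg_right h2 (Finset.prod_nonneg fun σ _ => by positivity)
      _ = C * ∏ σ, (2 * 2 ^ δ) * w (j σ) := by
            rw [mul_assoc, ← Finset.prod_mul_distrib]
            congr 1
            refine Finset.prod_congr rfl fun σ _ => ?_
            rw [zpow_add_one₀ (by norm_num)]
            have : (2 : ℝ) ^ j σ ≠ 0 := by positivity
            field_simp
      _ = _ := by
            rw [Finset.prod_mul_distrib, Finset.prod_const, Finset.card_univ, mul_assoc]
  rw [← Finset.sum_fiberwise_of_maps_to (t := S.image J) (g := J)
    (fun ν hν => Finset.mem_image_of_mem J hν)]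
  refine (Finset.sum_le_sum hfib).trans ?_
  rw [← Finset.mul_sum]
  refine mul_le_mul_of_nonneg_left ?_ (by positivity)
  -- Enlarging the set of boxes to a product set makes the sum factor.
  have hsub : S.image J ⊆ Fintype.piFinset fun σ => (S.image J).image fun j => j σ := by
    intro j hj
    rw [Fintype.mem_piFinset]
    exact fun σ => Finset.mem_image_of_mem _ hj
  calc _ ≤ ∑ j ∈ Fintype.piFinset fun σ => (S.image J).image fun j => j σ, ∏ σ, w (j σ) :=
        Finset.sum_le_sum_of_subset_of_nonneg hsub fun j _ _ =>
          Finset.prod_nonneg fun σ _ => (hw0 _).le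
    _ = ∏ σ, ∑ a ∈ (S.image J).image fun j => j σ, w a :=
        (Finset.prod_univ_sum _ fun _ a => w a).symm
    _ ≤ ∏ σ : F →+* ℝ, ∑' j, w j := by
        refine Finset.prod_le_prod (fun σ _ => Finset.sum_nonneg fun a _ => (hw0 a).le) fun σ _ => ?_
        exact (summable_two_rpow_neg_abs hδ).sum_le_tsum _ fun a _ => (hw0 a).le
    _ = _ := by rw [Finset.prod_const, Finset.card_univ]

lemma prod_latticeWeight_nonneg {I : FractionalIdeal (𝓞 F)⁰ F} (δ : ℝ) (ν : posOrZero I) :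
    0 ≤ ∏ σ : F →+* ℝ, latticeWeight δ (σ (ν : F)) := by
  refine Finset.prod_nonneg fun σ _ => ?_
  rcases ν.2 with h | h
  · exact (latticeWeight_pos (h.2 σ)).le
  · rw [Set.mem_singleton_iff.1 h, map_zero, latticeWeight_zero]

lemma summable_prod_latticeWeight (I : FractionalIdeal (𝓞 F)⁰ F) {δ : ℝ} (hδ : 0 < δ) :
    Summable fun ν : posOrZero I => ∏ σ : F →+* ℝ, latticeWeight δ (σ (ν : F)) := by
  classical
  obtain ⟨K, hK⟩ := exists_sum_latticeWeight_le I hδ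
  refine summable_of_sum_le (c := K) (fun ν => prod_latticeWeight_nonneg δ ν) fun S => ?_
  have h1 : ∑ ν ∈ S, ∏ σ : F →+* ℝ, latticeWeight δ (σ (ν : F)) =
      ∑ x ∈ S.map (Function.Embedding.subtype _), ∏ σ : F →+* ℝ, latticeWeight δ (σ x) := by
    rw [Finset.sum_map]
    rfl
  rw [h1, ← Finset.sum_filter_of_ne (p := fun x => x ≠ 0)]
  · refine hK _ fun ν hν => ?_
    obtain ⟨hν1, hν0⟩ := Finset.mem_filter.1 hν
    obtain ⟨μ, -, rfl⟩ := Finset.mem_map.1 hν1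
    exact μ.2.resolve_right hν0
  · intro x _ hx h0
    obtain ⟨σ⟩ := nonempty_realEmbeddings F
    refine hx (Finset.prod_eq_zero (Finset.mem_univ σ) ?_)
    rw [h0, map_zero, latticeWeight_zero]

/-- The vector `(c i + d)` in `ℂ^d`. -/
noncomputable def bottomVec : F × F →+ ((F →+* ℝ) → ℂ) where
  toFun p σ := (σ p.1 : ℂ) * Complex.I + (σ p.2 : ℂ)
  map_zero' := by ext; simp
  map_add' p q := by
    ext σ
    simp only [Prod.fst_add, Prod.snd_add, map_add, Complex.ofReal_add, Pi.add_apply]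
    ring

lemma abs_le_norm_bottomVec (p : F × F) (σ : F →+* ℝ) :
    |σ p.1| ≤ ‖bottomVec p σ‖ ∧ |σ p.2| ≤ ‖bottomVec p σ‖ := by
  constructor
  · refine le_trans (le_of_eq ?_) (Complex.abs_im_le_norm _)
    simp [bottomVec]
  · refine le_trans (le_of_eq ?_) (Complex.abs_re_le_norm _)
    simp [bottomVec]

/-- A short vector would give `c` and `d` norms too small for nonzero elements of `I` and `J`. The
`1` in the minimum ensures `‖v‖ ^ d ≤ ‖v‖`. -/
lemma exists_le_norm_bottomVec (I J : FractionalIdeal (𝓞 F)⁰ F) :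
    ∃ t : ℝ, 0 < t ∧ ∀ p : F × F, p.1 ∈ I → p.2 ∈ J → p ≠ 0 → t ≤ ‖bottomVec p‖ := by
  obtain ⟨c₁, hc₁, h₁⟩ := exists_le_prod_abs I
  obtain ⟨c₂, hc₂, h₂⟩ := exists_le_prod_abs J
  set d := Fintype.card (F →+* ℝ) with hd
  have := nonempty_realEmbeddings F
  have hd0 : d ≠ 0 := Fintype.card_ne_zero
  have key : ∀ x : F, ∀ p : F × F, (∀ σ : F →+* ℝ, |σ x| ≤ ‖bottomVec p σ‖) →
      ∏ σ : F →+* ℝ, |σ x| ≤ ‖bottomVec p‖ ^ d := by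
    intro x p h
    calc ∏ σ : F →+* ℝ, |σ x| ≤ ∏ σ : F →+* ℝ, ‖bottomVec p‖ :=
          Finset.prod_le_prod (fun _ _ => abs_nonneg _) fun σ _ => (h σ).trans (norm_le_pi_norm _ σ)
      _ = _ := by rw [Finset.prod_const, Finset.card_univ]
  refine ⟨min 1 (min c₁ c₂), by positivity, fun p hp1 hp2 hp => ?_⟩
  by_contra! hlt
  have h1 : ‖bottomVec p‖ ^ d < min c₁ c₂ := by
    calc ‖bottomVec p‖ ^ d ≤ ‖bottomVec p‖ ^ 1 :=
          pow_le_pow_of_le_one (norm_nonneg _) (hlt.le.trans (min_le_left _ _))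
            (Nat.one_le_iff_ne_zero.2 hd0)
      _ < _ := by rw [pow_one]; exact hlt.trans_le (min_le_right _ _)
  by_cases h0 : p.1 = 0
  · have h0' : p.2 ≠ 0 := fun h => hp (Prod.ext h0 h)
    have := (h₂ p.2 hp2 h0').trans (key p.2 p fun σ => (abs_le_norm_bottomVec p σ).2)
    linarith [min_le_right c₁ c₂]
  · have := (h₁ p.1 hp1 h0).trans (key p.1 p fun σ => (abs_le_norm_bottomVec p σ).1)
    linarith [min_le_left c₁ c₂]

/-- The gap `t` at the origin makes `G` discrete, so its rank over `ℤ` is at most the real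
dimension. -/
lemma AddSubgroup.summable_norm_rpow {E : Type*} [NormedAddCommGroup E] [NormedSpace ℝ E]
    [FiniteDimensional ℝ E] (G : AddSubgroup E) {t : ℝ} (ht : 0 < t)
    (hmin : ∀ x ∈ G, x ≠ 0 → t ≤ ‖x‖) {A : ℝ} (hA : (Module.finrank ℝ E : ℝ) < A) :
    Summable fun x : G => ‖(x : E)‖ ^ (-A) := by
  set L : Submodule ℤ E := G.toIntSubmodule with hL
  have : DiscreteTopology L := by
    refine DiscreteTopology.of_forall_le_norm ht fun x hx => hmin x x.2 ?_
    exact fun h => hx (Subtype.ext h)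
  have hrank : (Module.finrank ℤ L : ℝ) ≤ Module.finrank ℝ E := by
    have h1 := Real.finrank_eq_int_finrank_of_discrete (s := (L : Set E))
      (by rw [Submodule.span_eq]; infer_instance)
    have h2 := Submodule.finrank_le (Submodule.span ℝ (L : Set E))
    rw [Set.finrank, Set.finrank, Submodule.span_eq] at h1
    rw [h1] at h2
    exact_mod_cast h2
  exact ZLattice.summable_norm_rpow L (-A) (by linarith)

lemma summable_norm_bottomVec (I J : FractionalIdeal (𝓞 F)⁰ F) {A : ℝ}
    (hA : 2 * (Module.finrank ℚ F : ℝ) < A) {Q : Type*} (x : Q → F × F)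
    (hx : Function.Injective x) (hxI : ∀ q, (x q).1 ∈ I) (hxJ : ∀ q, (x q).2 ∈ J) :
    Summable fun q => ‖bottomVec (x q)‖ ^ (-A) := by
  obtain ⟨t, ht, hmin⟩ := exists_le_norm_bottomVec I J
  set G : AddSubgroup (F × F) :=
    (I : Submodule (𝓞 F) F).toAddSubgroup.prod (J : Submodule (𝓞 F) F).toAddSubgroup with hG
  have hGmem : ∀ p ∈ G, p.1 ∈ I ∧ p.2 ∈ J := fun p hp => AddSubgroup.mem_prod.1 hp
  have hxG : ∀ q, x q ∈ G := fun q => AddSubgroup.mem_prod.2 ⟨hxI q, hxJ q⟩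
  clear_value G
  have hrank : (Module.finrank ℝ ((F →+* ℝ) → ℂ) : ℝ) < A := by
    rw [Module.finrank_pi_fintype]
    simp only [Complex.finrank_real_complex, Finset.sum_const, Finset.card_univ,
      card_realEmbeddings, smul_eq_mul]
    push_cast
    linarith
  have h := (G.map bottomVec).summable_norm_rpow ht (by
    rintro _ ⟨p, hp, rfl⟩ h0
    exact hmin p (hGmem p hp).1 (hGmem p hp).2 (by rintro rfl; exact h0 (map_zero _))) hrank
  have hxm : ∀ q, bottomVec (x q) ∈ G.map bottomVec := fun q => ⟨x q, hxG q, rfl⟩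
  let i : Q → G.map bottomVec := fun q => ⟨bottomVec (x q), hxm q⟩
  have hi : Function.Injective i := by
    intro p q hpq
    by_contra hne
    have h1 : bottomVec (x p - x q) = 0 := by
      rw [map_sub, sub_eq_zero]
      exact congrArg (fun y : G.map bottomVec => (y : (F →+* ℝ) → ℂ)) hpq
    have h2 := hGmem _ (G.sub_mem (hxG p) (hxG q))
    have h3 := hmin _ h2.1 h2.2 (sub_ne_zero.2 fun h => hne (hx h))
    rw [h1, norm_zero] at h3
    exact ht.not_ge h3
  have h' : Summable ((fun y : G.map bottomVec => ‖(y : (F →+* ℝ) → ℂ)‖ ^ (-A)) ∘ i) :=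
    h.comp_injective hi
  exact h'

end LatticeSums

/-! ### The slash action and the cosets of `Γ_∞` -/

section Cosets

variable {F : Type*} [Field F] [NumberField F]

lemma denom_mul (γ M : GL (Fin 2) F) {z : (F →+* ℝ) → ℂ} (σ : F →+* ℝ)
    (h : (σ (M.1 1 0) : ℂ) * z σ + (σ (M.1 1 1) : ℂ) ≠ 0) :
    (σ ((γ * M).1 1 0) : ℂ) * z σ + (σ ((γ * M).1 1 1) : ℂ) =
      ((σ (γ.1 1 0) : ℂ) * moebius M z σ + (σ (γ.1 1 1) : ℂ)) *
        ((σ (M.1 1 0) : ℂ) * z σ + (σ (M.1 1 1) : ℂ)) := by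
  simp only [moebius, Units.val_mul, Matrix.mul_apply, Fin.sum_univ_two, map_add, map_mul,
    Complex.ofReal_add, Complex.ofReal_mul]
  field_simp
  ring

lemma moebius_mul (γ M : GL (Fin 2) F) {z : (F →+* ℝ) → ℂ}
    (h : ∀ σ : F →+* ℝ, (σ (M.1 1 0) : ℂ) * z σ + (σ (M.1 1 1) : ℂ) ≠ 0) :
    moebius (γ * M) z = moebius γ (moebius M z) := by
  ext σ
  have hσ := h σ
  have e : (σ ((γ * M).1 0 0) : ℂ) * z σ + (σ ((γ * M).1 0 1) : ℂ) =
      ((σ (γ.1 0 0) : ℂ) * moebius M z σ + (σ (γ.1 0 1) : ℂ)) *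
        ((σ (M.1 1 0) : ℂ) * z σ + (σ (M.1 1 1) : ℂ)) := by
    simp only [moebius, Units.val_mul, Matrix.mul_apply, Fin.sum_univ_two, map_add, map_mul,
      Complex.ofReal_add, Complex.ofReal_mul]
    field_simp
    ring
  rw [moebius, e, denom_mul γ M σ hσ, mul_div_mul_right _ _ hσ]
  rfl

lemma slash_mul (k : (F →+* ℝ) → ℕ) {γ M : GL (Fin 2) F} (hγ : TotallyPos γ.1.det)
    (hM : TotallyPos M.1.det) (f : ((F →+* ℝ) → ℂ) → ℂ) {z : (F →+* ℝ) → ℂ}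
    (hz : z ∈ upperHalfSpace (F →+* ℝ)) :
    slash k (γ * M) f z = slash k M (slash k γ f) z := by
  have hJ := denom_ne_zero hM hz
  simp only [slash]
  rw [moebius_mul γ M hJ, ← mul_assoc, ← Finset.prod_mul_distrib]
  congr 1
  refine Finset.prod_congr rfl fun σ _ => ?_
  rw [denom_mul γ M σ (hJ σ), Units.val_mul, Matrix.det_mul, map_mul,
    Real.mul_rpow (hγ σ).le (hM σ).le, mul_pow, mul_inv]
  push_cast
  ring

variable {𝔠 : FractionalIdeal (𝓞 F)⁰ F} {𝔫 : Ideal (𝓞 F)}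

lemma totallyPos_det_of_mem_Gamma0 {γ : GL (Fin 2) F} (hγ : γ ∈ Gamma0 𝔠 𝔫) :
    TotallyPos γ.1.det := by
  obtain ⟨-, -, -, -, u, hu, h⟩ := hγ
  rw [h]
  exact hu

lemma GammaInf_le_Gamma0 : GammaInf 𝔠 ≤ Gamma0 𝔠 𝔫 := by
  rintro γ ⟨ε, η, hε, b, hb, hγ⟩
  have e : γ.1 = !![(((ε * η : (𝓞 F)ˣ) : 𝓞 F) : F), (((ε * η : (𝓞 F)ˣ) : 𝓞 F) : F) * b;
      0, ((η : 𝓞 F) : F)] := by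
    have hm : (((ε * η : (𝓞 F)ˣ) : 𝓞 F) : F) = ((ε : 𝓞 F) : F) * ((η : 𝓞 F) : F) := by simp
    rw [hγ, hm]
    generalize ((ε : 𝓞 F) : F) = e
    generalize ((η : 𝓞 F) : F) = t
    ext i j
    fin_cases i <;> fin_cases j <;> simp
  refine ⟨?_, ?_, ?_, ?_, ε * η * η, ?_, ?_⟩
  · rw [e]; exact FractionalIdeal.coe_mem_one _ _
  · rw [e]; exact unit_mul_mem _ hb
  · rw [e]; exact FractionalIdeal.zero_mem _
  · rw [e]; exact FractionalIdeal.coe_mem_one _ _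
  · intro σ
    have h1 : σ ((η : 𝓞 F) : F) ≠ 0 := by simp
    have h2 : 0 < σ ((η : 𝓞 F) : F) * σ ((η : 𝓞 F) : F) := mul_self_pos.2 h1
    have := mul_pos (hε σ) h2
    simpa [mul_assoc] using this
  · rw [e, Matrix.det_fin_two]
    simp

/-- Allows the terms of the Poincaré series to be computed with balanced representatives. -/
lemma slash_mul_of_mem_GammaInf {k : (F →+* ℝ) → ℕ} {φ : ((F →+* ℝ) → ℂ) → ℂ}
    (hφ : IsGammaInfInvariant 𝔠 k φ) {γ M : GL (Fin 2) F} (hγ : γ ∈ GammaInf 𝔠)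
    (hM : TotallyPos M.1.det) {z : (F →+* ℝ) → ℂ} (hz : z ∈ upperHalfSpace (F →+* ℝ)) :
    slash k (γ * M) φ z = slash k M φ z := by
  -- The level is irrelevant to the determinant; `⊥` is a dummy.
  rw [slash_mul k (totallyPos_det_of_mem_Gamma0 (𝔫 := ⊥) (GammaInf_le_Gamma0 hγ)) hM φ hz, slash,
    hφ γ hγ _ (moebius_mem hM hz), ← slash]

lemma rep_mem (q : Cosets 𝔠 𝔫) : q.rep ∈ Gamma0 𝔠 𝔫 := (Quotient.out q).2

lemma eq_of_rep_mul_inv_mem {p q : Cosets 𝔠 𝔫} (h : q.rep * p.rep⁻¹ ∈ GammaInf 𝔠) : p = q := by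
  rw [← Quotient.out_eq p, ← Quotient.out_eq q]
  refine Quotient.sound ?_
  rw [← Quotient.eq_iff_equiv, Quotient.eq]
  rw [QuotientGroup.rightRel_apply, Subgroup.mem_subgroupOf]
  exact h

/-- The bottom row of a matrix. -/
def bottomRow (M : GL (Fin 2) F) : F × F := (M.1 1 0, M.1 1 1)

/-- The quotient is a unipotent `(1, b; 0, 1)`, with `b` in the right ideal because the quotient
lies in the group. Thus normalised representatives of different cosets have different bottom rows.
-/
lemma mem_GammaInf_of_bottomRow_eq {M N : GL (Fin 2) F} (hM : M ∈ Gamma0 𝔠 𝔫)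
    (hN : N ∈ Gamma0 𝔠 𝔫) (hM1 : M.1.det = 1) (hN1 : N.1.det = 1)
    (h : bottomRow M = bottomRow N) : M * N⁻¹ ∈ GammaInf 𝔠 := by
  have hmem : M * N⁻¹ ∈ Gamma0 𝔠 𝔫 := (Gamma0 𝔠 𝔫).mul_mem hM ((Gamma0 𝔠 𝔫).inv_mem hN)
  have hc : M.1 1 0 = N.1 1 0 := congrArg Prod.fst h
  have hd : M.1 1 1 = N.1 1 1 := congrArg Prod.snd h
  have hinv : ((N⁻¹ : GL (Fin 2) F) : Matrix (Fin 2) (Fin 2) F) =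
      !![N.1 1 1, -N.1 0 1; -N.1 1 0, N.1 0 0] := by
    rw [Matrix.coe_units_inv, Matrix.inv_def, Matrix.adjugate_fin_two, hN1]
    simp
  rw [Matrix.det_fin_two] at hM1 hN1
  refine ⟨1, 1, fun σ => by simp, _, hmem.2.1, ?_⟩
  have e : ∀ i j, (M * N⁻¹).1 i j = (M.1 * !![N.1 1 1, -N.1 0 1; -N.1 1 0, N.1 0 0]) i j := by
    intro i j
    rw [Units.val_mul, hinv]
  ext i j
  rw [e i j, e 0 1]
  fin_cases i <;> fin_cases j <;>
    simp only [Matrix.mul_apply, Fin.sum_univ_two, Fin.zero_eta, Fin.mk_one, Matrix.of_apply,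
      Matrix.cons_val', Matrix.cons_val_zero, Matrix.cons_val_one, Matrix.cons_val_fin_one,
      Units.val_one, map_one]
  · rw [← hc, ← hd]; linear_combination hM1
  · ring
  · rw [hc, hd]; ring
  · rw [hc, hd]; linear_combination hN1

variable [NumberField.IsTotallyReal F]

lemma bottomVec_apply (p : F × F) (σ : F →+* ℝ) :
    bottomVec p σ = (σ p.1 : ℂ) * Complex.I + (σ p.2 : ℂ) := rfl

variable (𝔠 𝔫) in
/-- Every coset in `Γ_∞ \ Γ` has a representative of determinant one whose bottom row is
balanced. -/
lemma exists_balanced_rep : ∃ B : ℝ, 0 < B ∧ ∀ q : Cosets 𝔠 𝔫, ∃ γ ∈ GammaInf 𝔠,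
    ∃ M ∈ Gamma0 𝔠 𝔫, q.rep = γ * M ∧ M.1.det = 1 ∧
      ∀ σ τ, ‖bottomVec (bottomRow M) σ‖ ≤ B * ‖bottomVec (bottomRow M) τ‖ := by
  obtain ⟨B, hB, hunit⟩ := exists_unit_balanced F
  refine ⟨B, hB, fun q => ?_⟩
  have hrep := rep_mem q
  obtain ⟨-, -, -, -, u, hu, hdet⟩ := id hrep
  have hz : (fun _ : F →+* ℝ => Complex.I) ∈ upperHalfSpace (F →+* ℝ) := fun σ => by simp
  obtain ⟨η, hη⟩ := hunit (fun σ => ‖bottomVec (bottomRow q.rep) σ‖) fun σ =>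
    norm_pos_iff.2 (denom_ne_zero (totallyPos_det_of_mem_Gamma0 hrep) hz σ)
  -- `diag(ε η, η)` has determinant `ε η² = u⁻¹`, which cancels the determinant of the
  -- representative, while its lower entry `η` balances the row.
  set ε : (𝓞 F)ˣ := u⁻¹ * η⁻¹ * η⁻¹ with hε
  have hη0 : ((η : 𝓞 F) : F) ≠ 0 := by simp
  have hu0 : ((u : 𝓞 F) : F) ≠ 0 := by simp
  have hεF : ((ε : 𝓞 F) : F) =
      ((u : 𝓞 F) : F)⁻¹ * ((η : 𝓞 F) : F)⁻¹ * ((η : 𝓞 F) : F)⁻¹ := by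
    rw [← unit_inv_coe, ← unit_inv_coe, hε]
    simp only [Units.val_mul, map_mul]
  have hεpos : TotallyPos ((ε : 𝓞 F) : F) := by
    intro σ
    have h1 : σ ((η : 𝓞 F) : F)⁻¹ ≠ 0 := by simp
    rw [hεF, mul_assoc, map_mul, map_mul, map_inv₀ σ ((u : 𝓞 F) : F)]
    exact mul_pos (inv_pos.2 (hu σ)) (mul_self_pos.2 h1)
  set T : GL (Fin 2) F := Matrix.GeneralLinearGroup.mkOfDetNeZero
    !![((ε : 𝓞 F) : F) * ((η : 𝓞 F) : F), 0; 0, ((η : 𝓞 F) : F)]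
    (by simp [Matrix.det_fin_two]) with hT
  have hTval : T.1 = !![((ε : 𝓞 F) : F) * ((η : 𝓞 F) : F), 0; 0, ((η : 𝓞 F) : F)] := rfl
  have hTmem : T ∈ GammaInf 𝔠 := by
    refine ⟨ε, η, hεpos, 0, FractionalIdeal.zero_mem _, ?_⟩
    rw [hTval]
    generalize ((ε : 𝓞 F) : F) = e
    generalize ((η : 𝓞 F) : F) = t
    ext i j
    fin_cases i <;> fin_cases j <;> simp
  refine ⟨T⁻¹, (GammaInf 𝔠).inv_mem hTmem, T * q.rep,
    (Gamma0 𝔠 𝔫).mul_mem (GammaInf_le_Gamma0 hTmem) hrep, by group, ?_, ?_⟩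
  · rw [Units.val_mul, Matrix.det_mul, hdet, hTval, Matrix.det_fin_two, hεF]
    simp only [Matrix.of_apply, Matrix.cons_val', Matrix.cons_val_zero, Matrix.cons_val_one,
      Matrix.cons_val_fin_one, mul_zero, sub_zero]
    field_simp
  · have hrow : ∀ σ, ‖bottomVec (bottomRow (T * q.rep)) σ‖ =
        |σ ((η : 𝓞 F) : F)| * ‖bottomVec (bottomRow q.rep) σ‖ := by
      intro σ
      have : bottomVec (bottomRow (T * q.rep)) σ =
          (σ ((η : 𝓞 F) : F) : ℂ) * bottomVec (bottomRow q.rep) σ := by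
        simp only [bottomVec_apply, bottomRow, Units.val_mul, hTval, Matrix.mul_apply,
          Fin.sum_univ_two, Matrix.of_apply, Matrix.cons_val', Matrix.cons_val_zero,
          Matrix.cons_val_one, Matrix.cons_val_fin_one, zero_mul, zero_add, map_mul,
          Complex.ofReal_mul]
        ring
      rw [this, norm_mul, Complex.norm_real, Real.norm_eq_abs]
    intro σ τ
    rw [hrow, hrow]
    exact hη σ τ

end Cosets

/-! ### Growth of `q`-series and convergence of Poincaré series -/

section Growth

lemma rpow_mul_exp_neg_le {u p : ℝ} (hu : 0 < u) (hp : 0 < p) :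
    u ^ p * Real.exp (-u) ≤ p ^ p := by
  have h1 : u / p ≤ Real.exp (u / p) := by linarith [Real.add_one_le_exp (u / p)]
  have h2 : (u / p) ^ p ≤ Real.exp u := by
    refine (Real.rpow_le_rpow (by positivity) h1 hp.le).trans_eq ?_
    rw [← Real.exp_mul, div_mul_cancel₀ _ hp.ne']
  rw [Real.div_rpow hu.le hp.le, div_le_iff₀ (by positivity)] at h2
  rw [Real.exp_neg, ← div_eq_mul_inv, div_le_iff₀ (Real.exp_pos u), mul_comm]
  exact h2

/-- Boundedness of `u^(s+δ) e^(-u)` at `u = x Y` gives the bound with `x^(-δ)`. It implies the one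
with `x^δ` if `x ≥ 1`; for `x < 1` that follows from `x^s ≤ x^δ`, since `s ≥ δ`. -/
lemma rpow_mul_exp_neg_le_latticeWeight {s δ Y x : ℝ} (hδ : 0 < δ) (hs : δ ≤ s) (hY : 0 < Y)
    (hY1 : Y ≤ 1) (hx : 0 < x) :
    x ^ (s - 1) * Real.exp (-(x * Y)) ≤
      max 1 ((s + δ) ^ (s + δ)) * Y ^ (-(s + δ)) * latticeWeight δ x := by
  have hp : 0 < s + δ := by linarith
  set K := max 1 ((s + δ) ^ (s + δ)) with hK
  have hK1 : 1 ≤ K := le_max_left _ _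
  have hYp : 1 ≤ Y ^ (-(s + δ)) := Real.one_le_rpow_of_pos_of_le_one_of_nonpos hY hY1 (by linarith)
  have h1 : x ^ s * Real.exp (-(x * Y)) ≤ K * Y ^ (-(s + δ)) * x ^ (-δ) := by
    have h2 := (rpow_mul_exp_neg_le (mul_pos hx hY) hp).trans (le_max_right 1 _)
    have h3 : x ^ s = (x * Y) ^ (s + δ) * Y ^ (-(s + δ)) * x ^ (-δ) := by
      rw [Real.mul_rpow hx.le hY.le, mul_assoc (x ^ (s + δ)), ← Real.rpow_add hY, add_neg_cancel,
        Real.rpow_zero, mul_one, ← Real.rpow_add hx, add_neg_cancel_right]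
    calc x ^ s * Real.exp (-(x * Y)) =
          (x * Y) ^ (s + δ) * Real.exp (-(x * Y)) * (Y ^ (-(s + δ)) * x ^ (-δ)) := by
            rw [h3]; ring
      _ ≤ K * (Y ^ (-(s + δ)) * x ^ (-δ)) := mul_le_mul_of_nonneg_right h2 (by positivity)
      _ = _ := by ring
  have h4 : x ^ s * Real.exp (-(x * Y)) ≤ K * Y ^ (-(s + δ)) * x ^ δ := by
    rcases le_or_gt 1 x with h | h
    · refine h1.trans (mul_le_mul_of_nonneg_left ?_ (by positivity))
      exact Real.rpow_le_rpow_of_exponent_le h (by linarith)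
    · calc x ^ s * Real.exp (-(x * Y)) ≤ x ^ s * 1 := by
            refine mul_le_mul_of_nonneg_left ?_ (by positivity)
            exact Real.exp_le_one_iff.2 (by nlinarith)
        _ ≤ x ^ δ := by
            rw [mul_one]
            exact Real.rpow_le_rpow_of_exponent_ge hx h.le hs
        _ ≤ _ := le_mul_of_one_le_left (by positivity) (one_le_mul_of_one_le_of_one_le hK1 hYp)
  rw [latticeWeight, ← mul_div_assoc, le_div_iff₀ hx, Real.rpow_sub_one hx.ne']
  calc x ^ s / x * Real.exp (-(x * Y)) * x = x ^ s * Real.exp (-(x * Y)) := by field_simp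
    _ ≤ _ := by
      rw [mul_min_of_nonneg _ _ (by positivity)]
      exact le_min h4 h1

variable {F : Type*} [Field F] [NumberField F]

lemma norm_qExp (ν : F) (z : (F →+* ℝ) → ℂ) :
    ‖qExp ν z‖ = ∏ σ : F →+* ℝ, Real.exp (-(2 * Real.pi * (σ ν * (z σ).im))) := by
  rw [qExp, Complex.norm_exp, ← Real.exp_sum]
  congr 1
  rw [mul_assoc, ← Complex.ofReal_ofNat, ← Complex.ofReal_mul, Complex.re_ofReal_mul,
    Complex.I_mul_re, Complex.im_sum, Finset.sum_neg_distrib, ← Finset.mul_sum, mul_neg]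
  simp

lemma differentiable_qExp (ν : F) : Differentiable ℂ (qExp ν) := by
  unfold qExp
  fun_prop

lemma qExp_zero (z : (F →+* ℝ) → ℂ) : qExp (0 : F) z = 1 := by simp [qExp]

variable [NumberField.IsTotallyReal F] {𝔠 : FractionalIdeal (𝓞 F)⁰ F}

/-- The growth condition may be assumed with a small exponent `ε`. -/
lemma CoeffBound.exists_small {l : (F →+* ℝ) → ℕ} {ε : ℝ} {a : F → ℂ} (hε : 0 < ε)
    (ha : CoeffBound 𝔠 l ε a) : ∃ ε', 0 < ε' ∧ ε' ≤ 1 / 4 ∧ ∃ C, 0 ≤ C ∧ ∀ ν ∈ 𝔠, TotallyPos ν →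
      ‖a ν‖ ≤ C * ∏ σ : F →+* ℝ, (σ ν) ^ ((l σ : ℝ) / 2 - 2 - ε') := by
  obtain ⟨C, hC⟩ := ha
  obtain ⟨c, hc, hI⟩ := exists_le_prod_abs 𝔠
  obtain ⟨σ₀⟩ := nonempty_realEmbeddings F
  refine ⟨min ε (1 / 4), by positivity, min_le_right _ _, |C| * c ^ (min ε (1 / 4) - ε),
    by positivity, fun ν hν hpos => ?_⟩
  set ε' := min ε (1 / 4)
  have hε' : ε' ≤ ε := min_le_left _ _
  have hν0 : ν ≠ 0 := by
    rintro rfl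
    simpa using hpos σ₀
  have h1 : c ≤ ∏ σ : F →+* ℝ, σ ν := by
    refine (hI ν hν hν0).trans_eq (Finset.prod_congr rfl fun σ _ => abs_of_pos (hpos σ))
  -- The discrepancy is a nonpositive power of the norm of `ν`, hence bounded, as norms from `𝔠⁺`
  -- are bounded below.
  have h2 : ∏ σ : F →+* ℝ, (σ ν) ^ ((l σ : ℝ) / 2 - 2 - ε) =
      (∏ σ : F →+* ℝ, σ ν) ^ (ε' - ε) * ∏ σ : F →+* ℝ, (σ ν) ^ ((l σ : ℝ) / 2 - 2 - ε') := by
    rw [← Real.finsetProd_rpow _ _ fun σ _ => (hpos σ).le, ← Finset.prod_mul_distrib]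
    refine Finset.prod_congr rfl fun σ _ => ?_
    rw [← Real.rpow_add (hpos σ)]
    congr 1
    ring
  have h3 : 0 < ∏ σ : F →+* ℝ, (σ ν) ^ ((l σ : ℝ) / 2 - 2 - ε') :=
    Finset.prod_pos fun σ _ => Real.rpow_pos_of_pos (hpos σ) _
  have h4 : 0 < ∏ σ : F →+* ℝ, σ ν := Finset.prod_pos fun σ _ => hpos σ
  refine (hC ν hν hpos).trans ?_
  rw [h2, mul_assoc]
  refine (mul_le_mul_of_nonneg_right (le_abs_self C) (by positivity)).trans ?_
  refine mul_le_mul_of_nonneg_left ?_ (abs_nonneg C)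
  exact mul_le_mul_of_nonneg_right
    (Real.rpow_le_rpow_of_nonpos hc h1 (by linarith)) h3.le

open scoped Classical in
/-- A majorant of the terms of a `q`-series. -/
lemma exists_norm_term_le {l : (F →+* ℝ) → ℕ} (hl : ∀ σ, 2 < l σ) {a : F → ℂ} {ε C : ℝ}
    (hε : 0 < ε) (hε4 : ε ≤ 1 / 4) (hC : 0 ≤ C) (ha : ∀ ν ∈ 𝔠, TotallyPos ν →
      ‖a ν‖ ≤ C * ∏ σ : F →+* ℝ, (σ ν) ^ ((l σ : ℝ) / 2 - 2 - ε)) :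
    ∃ K, 0 ≤ K ∧ ∀ Y, 0 < Y → Y ≤ 1 → ∀ w : (F →+* ℝ) → ℂ, (∀ σ, Y ≤ (w σ).im) →
      ∀ ν : posOrZero 𝔠, ‖a ν * qExp (ν : F) w‖ ≤ (if (ν : F) = 0 then ‖a 0‖ else 0) +
        K * Y ^ (-∑ σ : F →+* ℝ, ((l σ : ℝ) / 2 - 1 - ε / 2)) *
          ∏ σ : F →+* ℝ, latticeWeight (ε / 2) (σ (ν : F)) := by
  set s : (F →+* ℝ) → ℝ := fun σ => (l σ : ℝ) / 2 - 1 - ε with hs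
  have hδ : 0 < ε / 2 := by positivity
  -- Here `l ≥ 3` and `ε ≤ 1/4` enter: `s ≥ 1/2 - ε ≥ ε/2`.
  have hsδ : ∀ σ, ε / 2 ≤ s σ := by
    intro σ
    have : (3 : ℝ) ≤ l σ := by exact_mod_cast hl σ
    simp only [hs]
    linarith
  set k : (F →+* ℝ) → ℝ := fun σ => max 1 ((s σ + ε / 2) ^ (s σ + ε / 2)) with hk
  have hk0 : ∀ σ, 0 < k σ := fun σ => lt_max_of_lt_left one_pos
  have hK0 : 0 ≤ C * ∏ σ, k σ := mul_nonneg hC (Finset.prod_nonneg fun σ _ => (hk0 σ).le)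
  refine ⟨C * ∏ σ, k σ, hK0, fun Y hY hY1 w hw ν => ?_⟩
  rcases ν.2 with h | h
  · obtain ⟨hν, hpos⟩ := h
    refine le_add_of_nonneg_of_le (by split_ifs <;> simp) ?_
    have h1 : ∀ σ : F →+* ℝ, (σ (ν : F)) ^ ((l σ : ℝ) / 2 - 2 - ε) *
        Real.exp (-(2 * Real.pi * (σ (ν : F) * (w σ).im))) ≤
        k σ * Y ^ (-(s σ + ε / 2)) * latticeWeight (ε / 2) (σ (ν : F)) := by
      intro σ
      have e : (l σ : ℝ) / 2 - 2 - ε = s σ - 1 := by simp only [hs]; ring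
      rw [e]
      refine le_trans ?_ (rpow_mul_exp_neg_le_latticeWeight hδ (hsδ σ) hY hY1 (hpos σ))
      refine mul_le_mul_of_nonneg_left (Real.exp_le_exp.2 (neg_le_neg ?_))
        (Real.rpow_nonneg (hpos σ).le _)
      have h2 : σ (ν : F) * Y ≤ σ (ν : F) * (w σ).im :=
        mul_le_mul_of_nonneg_left (hw σ) (hpos σ).le
      have h3 : 0 < σ (ν : F) * Y := mul_pos (hpos σ) hY
      nlinarith [Real.pi_gt_three]
    calc ‖a ν * qExp (ν : F) w‖ ≤ (C * ∏ σ : F →+* ℝ, (σ (ν : F)) ^ ((l σ : ℝ) / 2 - 2 - ε)) *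
          ∏ σ : F →+* ℝ, Real.exp (-(2 * Real.pi * (σ (ν : F) * (w σ).im))) := by
            rw [norm_mul, norm_qExp]
            exact mul_le_mul_of_nonneg_right (ha ν hν hpos)
              (Finset.prod_nonneg fun _ _ => (Real.exp_pos _).le)
      _ ≤ C * ∏ σ : F →+* ℝ, k σ * Y ^ (-(s σ + ε / 2)) * latticeWeight (ε / 2) (σ (ν : F)) := by
            rw [mul_assoc, ← Finset.prod_mul_distrib]
            refine mul_le_mul_of_nonneg_left (Finset.prod_le_prod (fun σ _ => ?_) fun σ _ => h1 σ) hC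
            exact mul_nonneg (Real.rpow_nonneg (hpos σ).le _) (Real.exp_pos _).le
      _ = _ := by
            rw [Finset.prod_mul_distrib, Finset.prod_mul_distrib, ← Real.rpow_sum_of_pos hY,
              Finset.sum_neg_distrib]
            have : ∑ σ, (s σ + ε / 2) = ∑ σ : F →+* ℝ, ((l σ : ℝ) / 2 - 1 - ε / 2) :=
              Finset.sum_congr rfl fun σ _ => by simp only [hs]; ring
            rw [this]
            ring
  · have h0 : (ν : F) = 0 := h
    rw [if_pos h0, h0, qExp_zero, mul_one]
    refine le_add_of_nonneg_right (mul_nonneg (mul_nonneg hK0 (Real.rpow_nonneg hY.le _)) ?_)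
    rw [← h0]
    exact prod_latticeWeight_nonneg _ ν

open scoped Classical in
lemma summable_ite_posOrZero (c : ℝ) :
    Summable fun ν : posOrZero 𝔠 => if (ν : F) = 0 then c else 0 := by
  refine summable_of_ne_finset_zero (s := {⟨0, Or.inr rfl⟩}) fun ν hν => if_neg fun h => hν ?_
  rw [Finset.mem_singleton]
  exact Subtype.ext h

/-- Near each point of the upper half space the imaginary parts are bounded below. -/
lemma exists_ball_im {ι : Type*} [Fintype ι] {z₀ : ι → ℂ} (hz₀ : z₀ ∈ upperHalfSpace ι) :
    ∃ r > 0, r ≤ 1 ∧ Metric.ball z₀ r ⊆ upperHalfSpace ι ∧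
      ∀ z ∈ Metric.ball z₀ r, ∀ i, r ≤ (z i).im := by
  obtain ⟨m, hm0, hm⟩ : ∃ m > 0, ∀ i, m ≤ (z₀ i).im := by
    cases isEmpty_or_nonempty ι
    · exact ⟨1, one_pos, fun i => isEmptyElim i⟩
    · obtain ⟨i, hi⟩ := Finite.exists_min fun i => (z₀ i).im
      exact ⟨_, hz₀ i, hi⟩
  have key : ∀ z ∈ Metric.ball z₀ (min 1 (m / 2)), ∀ i, min 1 (m / 2) ≤ (z i).im := by
    intro z hz i
    rw [Metric.mem_ball, dist_eq_norm] at hz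
    have h1 := (Complex.abs_im_le_norm ((z - z₀) i)).trans ((norm_le_pi_norm (z - z₀) i).trans hz.le)
    rw [Pi.sub_apply, Complex.sub_im] at h1
    have h2 := (abs_le.1 h1).1
    have h3 := hm i
    have h4 := min_le_right 1 (m / 2)
    linarith
  have hpos : 0 < min 1 (m / 2) := by positivity
  exact ⟨_, hpos, min_le_left _ _, fun z hz i => hpos.trans_le (key z hz i), key⟩

section QSeries

variable {l : (F →+* ℝ) → ℕ} (hl : ∀ σ, 2 < l σ) {a : F → ℂ} {ε C : ℝ}
    (hε : 0 < ε) (hε4 : ε ≤ 1 / 4) (hC : 0 ≤ C) (ha : ∀ ν ∈ 𝔠, TotallyPos ν →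
      ‖a ν‖ ≤ C * ∏ σ : F →+* ℝ, (σ ν) ^ ((l σ : ℝ) / 2 - 2 - ε))

include hl hε hε4 hC ha

lemma differentiableOn_qSeries :
    DifferentiableOn ℂ (qSeries 𝔠 a) (upperHalfSpace (F →+* ℝ)) := by
  classical
  obtain ⟨K, hK, hterm⟩ := exists_norm_term_le hl hε hε4 hC ha
  refine NormallySummable.differentiableOn_tsum
    (g := fun (ν : posOrZero 𝔠) z => a ν * qExp (ν : F) z) ?_
    fun ν => ((differentiable_qExp (ν : F)).const_mul _).differentiableOn
  intro z₀ hz₀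
  obtain ⟨r, hr, hr1, hsub, him⟩ := exists_ball_im hz₀
  exact ⟨r, hr, hsub, _, (summable_ite_posOrZero ‖a 0‖).add
    ((summable_prod_latticeWeight 𝔠 (half_pos hε)).mul_left _),
    fun ν z hz => hterm r hr hr1 z (him z hz) ν⟩

/-- The weighted sum over `ν` is independent of `Y`. The constant term is absorbed because `Y ^ (-S)
≥ 1` for `Y ≤ 1` and `S ≥ 0`. -/
lemma exists_norm_qSeries_le : ∃ K, 0 ≤ K ∧ ∀ Y, 0 < Y → Y ≤ 1 → ∀ w : (F →+* ℝ) → ℂ,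
    (∀ σ, Y ≤ (w σ).im) →
      ‖qSeries 𝔠 a w‖ ≤ K * Y ^ (-∑ σ : F →+* ℝ, ((l σ : ℝ) / 2 - 1 - ε / 2)) := by
  classical
  obtain ⟨K, hK, hterm⟩ := exists_norm_term_le hl hε hε4 hC ha
  have hW := summable_prod_latticeWeight 𝔠 (half_pos hε)
  set W : ℝ := ∑' ν : posOrZero 𝔠, ∏ σ : F →+* ℝ, latticeWeight (ε / 2) (σ (ν : F))
  have hW0 : 0 ≤ W := tsum_nonneg fun ν => prod_latticeWeight_nonneg _ ν
  set A : ℝ := ∑' ν : posOrZero 𝔠, if (ν : F) = 0 then ‖a 0‖ else 0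
  have hA0 : 0 ≤ A := tsum_nonneg fun ν => by split_ifs <;> simp
  refine ⟨A + K * W, by positivity, fun Y hY hY1 w hw => ?_⟩
  set S : ℝ := ∑ σ : F →+* ℝ, ((l σ : ℝ) / 2 - 1 - ε / 2)
  have hS : 0 ≤ S := Finset.sum_nonneg fun σ _ => by
    have : (3 : ℝ) ≤ l σ := by exact_mod_cast hl σ
    linarith
  have hYS : 1 ≤ Y ^ (-S) := Real.one_le_rpow_of_pos_of_le_one_of_nonpos hY hY1 (by linarith)
  have h1 := (summable_ite_posOrZero (𝔠 := 𝔠) ‖a 0‖).add (hW.mul_left (K * Y ^ (-S)))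
  calc ‖qSeries 𝔠 a w‖ ≤ ∑' ν : posOrZero 𝔠, ((if (ν : F) = 0 then ‖a 0‖ else 0) +
        K * Y ^ (-S) * ∏ σ : F →+* ℝ, latticeWeight (ε / 2) (σ (ν : F))) :=
        tsum_of_norm_bounded h1.hasSum fun ν => hterm Y hY hY1 w hw ν
    _ = A + K * Y ^ (-S) * W := by
        rw [(summable_ite_posOrZero ‖a 0‖).tsum_add (hW.mul_left _), tsum_mul_left]
    _ ≤ A * Y ^ (-S) + K * Y ^ (-S) * W :=
        add_le_add_left (le_mul_of_one_le_right hA0 hYS) _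
    _ = _ := by ring

end QSeries

/-- Near each point `z₀` of the upper half space `c z + d` is comparable to `c i + d`. -/
lemma exists_ball_compare {ι : Type*} [Fintype ι] {z₀ : ι → ℂ} (hz₀ : z₀ ∈ upperHalfSpace ι) :
    ∃ r > 0, Metric.ball z₀ r ⊆ upperHalfSpace ι ∧ ∃ κ > 0, ∀ z ∈ Metric.ball z₀ r, ∀ i,
      ∀ c d : ℝ, κ * ‖(c : ℂ) * Complex.I + d‖ ≤ ‖(c : ℂ) * z i + d‖ ∧
        κ * ‖(c : ℂ) * z i + d‖ ^ 2 ≤ (z i).im * ‖(c : ℂ) * Complex.I + d‖ ^ 2 := by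
  obtain ⟨r, hr, -, hsub, him⟩ := exists_ball_im hz₀
  set R := ‖z₀‖ + r with hR
  have hR0 : 0 ≤ R := by positivity
  -- The first entry comes from `|c| r ≤ |c z + d|` and `|d| ≤ |c z + d| + |c| R`, the second from
  -- `|c z + d| ≤ (R + 1) |c i + d|` and `r ≤ Im z`.
  refine ⟨r, hr, hsub, min ((1 + R) / r + 1)⁻¹ (r / (R + 1) ^ 2), by positivity, ?_⟩
  intro z hz i c d
  have hzi : ‖z i‖ ≤ R := by
    rw [Metric.mem_ball, dist_eq_norm] at hz
    have h1 := norm_le_pi_norm (z - z₀) i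
    have h2 := norm_le_pi_norm z₀ i
    have h3 := norm_le_norm_add_norm_sub' (z i) (z₀ i)
    simp only [Pi.sub_apply] at h1
    linarith
  set n := ‖(c : ℂ) * Complex.I + d‖
  set p := ‖(c : ℂ) * z i + d‖
  have hc : |c| ≤ n := by simpa [n] using Complex.abs_im_le_norm ((c : ℂ) * Complex.I + d)
  have hd : |d| ≤ n := by simpa [n] using Complex.abs_re_le_norm ((c : ℂ) * Complex.I + d)
  have hn : n ≤ |c| + |d| := by simpa [n] using norm_add_le ((c : ℂ) * Complex.I) (d : ℂ)
  have hcz : ‖(c : ℂ) * z i‖ ≤ |c| * R := by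
    rw [norm_mul, Complex.norm_real, Real.norm_eq_abs]
    exact mul_le_mul_of_nonneg_left hzi (abs_nonneg c)
  have hp : p ≤ |c| * R + |d| := by
    have := norm_add_le ((c : ℂ) * z i) (d : ℂ)
    rw [Complex.norm_real, Real.norm_eq_abs] at this
    linarith
  have hcr : |c| * r ≤ p := by
    have h1 := Complex.abs_im_le_norm ((c : ℂ) * z i + d)
    simp only [Complex.add_im, Complex.mul_im, Complex.ofReal_re, Complex.ofReal_im, zero_mul,
      add_zero, abs_mul] at h1
    refine le_trans (mul_le_mul_of_nonneg_left ?_ (abs_nonneg c)) h1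
    exact (him z hz i).trans (le_abs_self _)
  have hdp : |d| ≤ p + |c| * R := by
    have h1 := norm_sub_le ((c : ℂ) * z i + d) ((c : ℂ) * z i)
    rw [add_sub_cancel_left, Complex.norm_real, Real.norm_eq_abs] at h1
    linarith
  have hp0 : 0 ≤ p := norm_nonneg _
  have hn0 : 0 ≤ n := norm_nonneg _
  constructor
  · refine (mul_le_mul_of_nonneg_right (min_le_left _ _) hn0).trans ?_
    rw [inv_mul_le_iff₀ (by positivity)]
    have h1 : |c| ≤ p / r := (le_div_iff₀ hr).2 hcr
    have h2 : |c| * (1 + R) ≤ p / r * (1 + R) := mul_le_mul_of_nonneg_right h1 (by linarith)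
    calc n ≤ |c| * (1 + R) + p := by linarith
      _ ≤ p / r * (1 + R) + p := by linarith
      _ = _ := by ring
  · refine (mul_le_mul_of_nonneg_right (min_le_right _ _) (by positivity)).trans ?_
    have h1 : p ≤ (R + 1) * n := by
      have := mul_le_mul_of_nonneg_right hc hR0
      linarith
    have h2 : p ^ 2 ≤ (R + 1) ^ 2 * n ^ 2 := by
      rw [← mul_pow]
      exact pow_le_pow_left₀ hp0 h1 2
    calc r / (R + 1) ^ 2 * p ^ 2 ≤ r / (R + 1) ^ 2 * ((R + 1) ^ 2 * n ^ 2) :=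
          mul_le_mul_of_nonneg_left h2 (by positivity)
      _ = r * n ^ 2 := by field_simp
      _ ≤ _ := mul_le_mul_of_nonneg_right (him z hz i) (by positivity)

/-- The terms of the Poincaré series are normally summable. -/
theorem normallySummable_slash_rep {𝔫 : Ideal (𝓞 F)} {l : (F →+* ℝ) → ℕ} (hl : ∀ σ, 2 < l σ)
    {a : F → ℂ} (hinv : IsGammaInfInvariant 𝔠 l (qSeries 𝔠 a)) {ε C : ℝ}
    (hε : 0 < ε) (hε4 : ε ≤ 1 / 4) (hC : 0 ≤ C) (ha : ∀ ν ∈ 𝔠, TotallyPos ν →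
      ‖a ν‖ ≤ C * ∏ σ : F →+* ℝ, (σ ν) ^ ((l σ : ℝ) / 2 - 2 - ε)) :
    NormallySummable (fun q : Cosets 𝔠 𝔫 => slash l q.rep (qSeries 𝔠 a))
      (upperHalfSpace (F →+* ℝ)) := by
  obtain ⟨B, hB, hrep⟩ := exists_balanced_rep 𝔠 𝔫
  choose γ hγ M hM hqM hdet hbal using hrep
  obtain ⟨K, hK, hbound⟩ := exists_norm_qSeries_le hl hε hε4 hC ha
  set I := 𝔠 * different F * (𝔫 : FractionalIdeal (𝓞 F)⁰ F) with hI
  obtain ⟨t, ht, hmin⟩ := exists_le_norm_bottomVec I (1 : FractionalIdeal (𝓞 F)⁰ F)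
  have hrow : ∀ q, (bottomRow (M q)).1 ∈ I ∧
      (bottomRow (M q)).2 ∈ (1 : FractionalIdeal (𝓞 F)⁰ F) :=
    fun q => ⟨(hM q).2.2.1, (hM q).2.2.2.1⟩
  have hrowinj : Function.Injective fun q => bottomRow (M q) := by
    intro p q hpq
    have h1 := mem_GammaInf_of_bottomRow_eq (hM q) (hM p) (hdet q) (hdet p) hpq.symm
    refine eq_of_rep_mul_inv_mem ?_
    rw [hqM p, hqM q, mul_inv_rev, show γ q * M q * ((M p)⁻¹ * (γ p)⁻¹) =
      γ q * (M q * (M p)⁻¹) * (γ p)⁻¹ by group]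
    exact (GammaInf 𝔠).mul_mem ((GammaInf 𝔠).mul_mem (hγ q) h1) ((GammaInf 𝔠).inv_mem (hγ p))
  set T : Cosets 𝔠 𝔫 → ℝ := fun q => ‖bottomVec (bottomRow (M q))‖ with hT
  have hrow0 : ∀ q, bottomRow (M q) ≠ 0 := by
    intro q h
    have h1 := hdet q
    have hc : (M q).1 1 0 = 0 := congrArg Prod.fst h
    have hd : (M q).1 1 1 = 0 := congrArg Prod.snd h
    rw [Matrix.det_fin_two, hc, hd] at h1
    simp at h1
  have hTt : ∀ q, t ≤ T q := fun q => hmin _ (hrow q).1 (hrow q).2 (hrow0 q)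
  have hT0 : ∀ q, 0 < T q := fun q => ht.trans_le (hTt q)
  set d : ℝ := (Module.finrank ℚ F : ℝ) with hd
  have hd0 : 0 < d := Nat.cast_pos.2 Module.finrank_pos
  have hsum : Summable fun q => T q ^ (-(d * (2 + ε))) :=
    summable_norm_bottomVec I 1 (by nlinarith) (fun q => bottomRow (M q)) hrowinj
      (fun q => (hrow q).1) fun q => (hrow q).2
  intro z₀ hz₀
  obtain ⟨r, hr, hsub, κ, hκ, hcmp⟩ := exists_ball_compare hz₀
  set S : ℝ := ∑ σ : F →+* ℝ, ((l σ : ℝ) / 2 - 1 - ε / 2) with hS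
  -- The entry `t ^ 2` guarantees `Y = κ' / T² ≤ 1`, as the bound for the q-series requires.
  set κ' := min κ (t ^ 2) with hκ'
  have hκ'0 : 0 < κ' := by positivity
  refine ⟨r, hr, hsub, fun q => (((κ / B) ^ ∑ σ, l σ)⁻¹ * (K * κ' ^ (-S))) *
    T q ^ (-(d * (2 + ε))), hsum.mul_left _, fun q z hz => ?_⟩
  have hzU := hsub hz
  have hMpos : TotallyPos (M q).1.det := totallyPos_det_of_mem_Gamma0 (hM q)
  have hterm : slash l q.rep (qSeries 𝔠 a) z = slash l (M q) (qSeries 𝔠 a) z := by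
    rw [hqM q]
    exact slash_mul_of_mem_GammaInf hinv (hγ q) hMpos hzU
  set J : (F →+* ℝ) → ℂ := fun σ => (σ ((M q).1 1 0) : ℂ) * z σ + (σ ((M q).1 1 1) : ℂ) with hJ
  -- Balancedness is used here: every factor `c z + d`, not just the largest, has size at least a
  -- constant times `T`.
  have hJ1 : ∀ σ, κ / B * T q ≤ ‖J σ‖ := by
    intro σ
    refine le_trans ?_ (hcmp z hz σ _ _).1
    rw [div_mul_eq_mul_div, mul_div_assoc]
    refine mul_le_mul_of_nonneg_left ?_ hκ.le
    rw [div_le_iff₀' hB]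
    exact (pi_norm_le_iff_of_nonneg (by positivity)).2 fun τ => hbal q τ σ
  have hJ0 : ∀ σ, 0 < ‖J σ‖ := fun σ => norm_pos_iff.2 (denom_ne_zero hMpos hzU σ)
  have him : ∀ σ, κ' / T q ^ 2 ≤ (moebius (M q) z σ).im := by
    intro σ
    rw [im_moebius_apply, hdet, map_one, one_mul, div_le_div_iff₀ (by have := hT0 q; positivity)
      (by have := hJ0 σ; positivity)]
    calc κ' * ‖J σ‖ ^ 2 ≤ κ * ‖J σ‖ ^ 2 :=
          mul_le_mul_of_nonneg_right (min_le_left _ _) (by positivity)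
      _ ≤ (z σ).im * ‖bottomVec (bottomRow (M q)) σ‖ ^ 2 := (hcmp z hz σ _ _).2
      _ ≤ (z σ).im * T q ^ 2 := by
          refine mul_le_mul_of_nonneg_left ?_ (hzU σ).le
          exact pow_le_pow_left₀ (norm_nonneg _) (norm_le_pi_norm _ σ) 2
  have hY1 : κ' / T q ^ 2 ≤ 1 := by
    rw [div_le_one (by have := hT0 q; positivity)]
    exact (min_le_right _ _).trans (pow_le_pow_left₀ ht.le (hTt q) 2)
  have hφ := hbound _ (div_pos hκ'0 (by have := hT0 q; positivity)) hY1 _ him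
  have hprod : ∏ σ, (‖J σ‖ ^ l σ)⁻¹ ≤ ((κ / B) ^ ∑ σ, l σ)⁻¹ * (T q ^ ∑ σ, l σ)⁻¹ := by
    rw [← mul_inv, ← mul_pow, ← Finset.prod_pow_eq_pow_sum, ← Finset.prod_inv_distrib]
    refine Finset.prod_le_prod (fun σ _ => by positivity) fun σ _ => ?_
    have h1 : 0 < κ / B * T q := by have := hT0 q; positivity
    exact inv_anti₀ (pow_pos h1 _) (pow_le_pow_left₀ h1.le (hJ1 σ) _)
  have hexp : (T q ^ ∑ σ, l σ)⁻¹ * (κ' / T q ^ 2) ^ (-S) =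
      κ' ^ (-S) * T q ^ (-(d * (2 + ε))) := by
    -- The automorphy factor contributes `T^(-∑ l)` and the q-series `T^(2S)`; the surplus `d ε`
    -- over the dimension `2d` makes the sum converge.
    have h1 : d * (2 + ε) = ((∑ σ, l σ : ℕ) : ℝ) - 2 * S := by
      rw [hS, Finset.sum_sub_distrib, Finset.sum_sub_distrib, ← Finset.sum_div, Finset.sum_const,
        Finset.sum_const, Finset.card_univ, card_realEmbeddings, nsmul_eq_mul, nsmul_eq_mul]
      push_cast
      ring
    rw [Real.div_rpow hκ'0.le (by positivity), ← Real.rpow_natCast (T q) 2,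
      ← Real.rpow_mul (hT0 q).le, h1, neg_sub, Real.rpow_sub (hT0 q), Real.rpow_natCast]
    rw [show ((2 : ℕ) : ℝ) * -S = -(2 * S) by push_cast; ring, Real.rpow_neg (hT0 q).le]
    have h2 : T q ^ (2 * S) ≠ 0 := (Real.rpow_pos_of_pos (hT0 q) _).ne'
    have h3 : T q ^ (∑ σ, l σ) ≠ 0 := (pow_pos (hT0 q) _).ne'
    field_simp
  change ‖slash l q.rep (qSeries 𝔠 a) z‖ ≤
    (((κ / B) ^ ∑ σ, l σ)⁻¹ * (K * κ' ^ (-S))) * T q ^ (-(d * (2 + ε)))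
  rw [hterm, slash, norm_mul, norm_prod]
  have hnorm : ∀ σ : F →+* ℝ, ‖(((σ (M q).1.det) ^ ((l σ : ℝ) / 2) : ℝ) : ℂ) *
      (((σ ((M q).1 1 0) : ℂ) * z σ + (σ ((M q).1 1 1) : ℂ)) ^ (l σ))⁻¹‖ = (‖J σ‖ ^ l σ)⁻¹ := by
    intro σ
    rw [hdet, map_one, Real.one_rpow, Complex.ofReal_one, one_mul, norm_inv, norm_pow]
  rw [Finset.prod_congr rfl fun σ _ => hnorm σ]
  calc _ ≤ (((κ / B) ^ ∑ σ, l σ)⁻¹ * (T q ^ ∑ σ, l σ)⁻¹) * (K * (κ' / T q ^ 2) ^ (-S)) :=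
        mul_le_mul hprod hφ (norm_nonneg _) (by have := hT0 q; positivity)
    _ = ((κ / B) ^ ∑ σ, l σ)⁻¹ * K * ((T q ^ ∑ σ, l σ)⁻¹ * (κ' / T q ^ 2) ^ (-S)) := by ring
    _ = _ := by rw [hexp]; ring

end Growth

/-! ### Rankin-Cohen brackets and Poincaré series -/

section Main

variable {F : Type*} [Field F] [NumberField F]

lemma differentiableOn_slash (k : (F →+* ℝ) → ℕ) {γ : GL (Fin 2) F} (hγ : TotallyPos γ.1.det)
    {f : ((F →+* ℝ) → ℂ) → ℂ} (hf : DifferentiableOn ℂ f (upperHalfSpace (F →+* ℝ))) :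
    DifferentiableOn ℂ (slash k γ f) (upperHalfSpace (F →+* ℝ)) := by
  have hJ : ∀ σ : F →+* ℝ, ∀ z ∈ upperHalfSpace (F →+* ℝ),
      (σ (γ.1 1 0) : ℂ) * z σ + (σ (γ.1 1 1) : ℂ) ≠ 0 := fun σ z hz => denom_ne_zero hγ hz σ
  have hm : DifferentiableOn ℂ (moebius γ) (upperHalfSpace (F →+* ℝ)) := by
    rw [differentiableOn_pi]
    intro σ
    simp only [moebius, div_eq_mul_inv]
    exact DifferentiableOn.fun_mul (by fun_prop) (DifferentiableOn.inv (by fun_prop) (hJ σ))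
  refine DifferentiableOn.fun_mul ?_ (hf.comp hm fun z hz => moebius_mem hγ hz)
  have hfac : ∀ σ : F →+* ℝ, DifferentiableOn ℂ (fun z : (F →+* ℝ) → ℂ =>
      (((σ γ.1.det) ^ ((k σ : ℝ) / 2) : ℝ) : ℂ) *
        (((σ (γ.1 1 0) : ℂ) * z σ + (σ (γ.1 1 1) : ℂ)) ^ (k σ))⁻¹) (upperHalfSpace (F →+* ℝ)) :=
    fun σ => DifferentiableOn.const_mul
      (DifferentiableOn.inv (by fun_prop) fun z hz => pow_ne_zero _ (hJ σ z hz)) _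
  classical
  intro z hz
  exact (HasFDerivWithinAt.finsetProd fun σ _ =>
    (hfac σ z hz).hasFDerivWithinAt).differentiableWithinAt

open scoped Classical in
/-- The Rankin-Cohen bracket with a normally convergent series may be formed term by term. -/
lemma hasSum_rankinCohen {ι Q : Type*} [Fintype ι] (k l n : ι → ℕ) {U : Set (ι → ℂ)}
    (hU : IsOpen U) (f : (ι → ℂ) → ℂ) {g : Q → (ι → ℂ) → ℂ} (h : NormallySummable g U)
    (hg : ∀ q, DifferentiableOn ℂ (g q) U) {z : ι → ℂ} (hz : z ∈ U) :
    HasSum (fun q => rankinCohen k l n f (g q) z)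
      (rankinCohen k l n f (fun y => ∑' q, g q y) z) := by
  unfold rankinCohen
  refine hasSum_sum fun m _ => HasSum.mul_left _ ?_
  obtain ⟨h1, h2⟩ := h.multiDeriv hU hg (n - m)
  rw [h2 hz]
  exact (h1.summable_norm hz).of_norm.hasSum

end Main

theorem mainTheorem11 {F : Type*} [Field F] [NumberField F] [NumberField.IsTotallyReal F]
    (hd : 1 < Module.finrank ℚ F)
    (𝔠 : FractionalIdeal (𝓞 F)⁰ F) (h𝔠 : 𝔠 ≠ 0) (𝔫 : Ideal (𝓞 F)) (h𝔫 : 𝔫 ≠ ⊥)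
    (k l n : (F →+* ℝ) → ℕ) (hl : ∀ σ, 2 < l σ)
    (f : ((F →+* ℝ) → ℂ) → ℂ) (hf : IsHilbertModularForm 𝔠 𝔫 k f)
    (a : F → ℂ) (hinv : IsGammaInfInvariant 𝔠 l (qSeries 𝔠 a))
    (ε : ℝ) (hε : 0 < ε) (ha : CoeffBound 𝔠 l ε a)
    (hcusp : ¬ IsCuspForm 𝔠 𝔫 k f → ∀ σ, k σ + 2 ≤ l σ) :
    (∀ z ∈ upperHalfSpace (F →+* ℝ), Summable (poincareTerm 𝔠 𝔫 l (qSeries 𝔠 a) z)) ∧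
    DifferentiableOn ℂ (poincare 𝔠 𝔫 l (qSeries 𝔠 a)) (upperHalfSpace (F →+* ℝ)) ∧
    (∀ z ∈ upperHalfSpace (F →+* ℝ),
      Summable (poincareTerm 𝔠 𝔫 (k + l + 2 * n) (rankinCohen k l n f (qSeries 𝔠 a)) z)) ∧
    ∀ z ∈ upperHalfSpace (F →+* ℝ),
      rankinCohen k l n f (poincare 𝔠 𝔫 l (qSeries 𝔠 a)) z =
        poincare 𝔠 𝔫 (k + l + 2 * n) (rankinCohen k l n f (qSeries 𝔠 a)) z := by
  obtain ⟨ε', hε', hε4, C, hC, ha'⟩ := CoeffBound.exists_small hε ha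
  have hnormal := normallySummable_slash_rep (𝔫 := 𝔫) hl hinv hε' hε4 hC ha'
  have hφ := differentiableOn_qSeries hl hε' hε4 hC ha'
  have hdet : ∀ q : Cosets 𝔠 𝔫, TotallyPos q.rep.1.det := fun q =>
    totallyPos_det_of_mem_Gamma0 (rep_mem q)
  have hdiff : ∀ q : Cosets 𝔠 𝔫, DifferentiableOn ℂ (slash l q.rep (qSeries 𝔠 a))
      (upperHalfSpace (F →+* ℝ)) := fun q => differentiableOn_slash l (hdet q) hφ
  have hbracket : ∀ z ∈ upperHalfSpace (F →+* ℝ),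
      HasSum (poincareTerm 𝔠 𝔫 (k + l + 2 * n) (rankinCohen k l n f (qSeries 𝔠 a)) z)
        (rankinCohen k l n f (poincare 𝔠 𝔫 l (qSeries 𝔠 a)) z) := by
    intro z hz
    refine (hasSum_rankinCohen k l n isOpen_upperHalfSpace f hnormal hdiff hz).congr_fun fun q => ?_
    -- The term is `[f|_k M, φ|_l M]_n`, and `f|_k M` equals `f` only on the upper half space; since
    -- that set is open, the derivatives agree there too.
    rw [poincareTerm, ← rankinCohen_slash k l n (hdet q) hf.holo hφ hz]
    exact multiDeriv_congr_rankinCohen isOpen_upperHalfSpace (hf.slash_eq _ (rep_mem q)) hz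
  exact ⟨fun z hz => (hnormal.summable_norm hz).of_norm, hnormal.differentiableOn_tsum hdiff,
    fun z hz => (hbracket z hz).summable, fun z hz => (hbracket z hz).tsum_eq.symm⟩
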